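/- Let $\mathbb T^3=(\mathbb R/2\pi\mathbb Z)^3\equiv[-\pi,\pi)^3$ with Lebesgue measure $dp$, and let $L^{2,\mathrm e}(\mathbb T^3)$ be the Hilbert space of complex-valued square-integrable functions $f$ on $\mathbb T^3$ with $f(-p)=f(p)$ for almost every $p$. For $\mu_1,\mu_2\in\mathbb R$ and $K\in\mathbb T^3$, represented by $(K_1,K_2,K_3)\in[-\pi,\pi)^3$, let $H_{\mu_1\mu_2}(K)$ be the bounded self-adjoint operator on $L^{2,\mathrm e}(\mathbb T^3)$ given by $$(H_{\mu_1\mu_2}(K)f)(p)=\mathcal E_K(p)f(p)+\frac{\mu_1}{(2\pi)^3}\int_{\mathbb T^3}f(q)\,dq+\frac{2\mu_2}{(2\pi)^3}\sum_{i=1}^3\cos p_i\int_{\mathbb T^3}\cos q_i\,f(q)\,dq,$$ $$\mathcal E_K(p)=4\sum_{i=1}^3\Bigl(1-\cos\tfrac{K_i}{2}\cos p_i\Bigr).$$ Put $$a_{11}=\frac1{8\pi^3}\int_{\mathbb T^3}\frac{dp}{\mathcal E_0(p)},\qquad a=\frac1{8\pi^3}\int_{\mathbb T^3}\frac{(\cos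 p_1-\cos p_2)^2}{\mathcal E_0(p)}\,dp,\qquad \mu_0=\frac{24a_{11}}{12a_{11}-1},\qquad \mu_2^{(0)}=\frac1a,$$ $$\mu_2^-(\mu_1)=\frac{24}{\mu_1+12}-\mu_0\ \ (\mu_1\ne-12),\qquad \mu_2^+(\mu_1)=\frac{24}{\mu_1-12}+\mu_0\ \ (\mu_1\neq 12).$$ Define subsets of the $(\mu_1,\mu_2)$-plane by $$\begin{aligned} \mathcal A_0^-&=\{\mu_1>-12,\ \mu_2>\mu_2^-(\mu_1)\},\qquad \mathcal A_2^-=\{\mu_1<-12,\ \mu_2<\mu_2^-(\mu_1)\},\\ \mathcal A_1^-&=\{\mu_1>-12,\ \mu_2<\mu_2^-(\mu_1)\}\cup\{\mu_1=-12\}\cup\{\mu_1<-12,\ \mu_2>\mu_2^-(\mu_1)\},\\ \mathcal A_0^+&=\{\mu_1<12,\ \mu_2<\mu_2^+(\mu_1)\},\qquad \mathcal A_2^+=\{\mu_1>12,\ \mu_2>\mu_2^+(\mu_1)\},\\ \mathcal A_1^+&=\{\mu_1<12,\ \mu_2>\mu_2^+(\mu_1)\}\cup\{\mu_1=12\}\cup\{\mu_1>12,\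 \mu_2<\mu_2^+(\mu_1)\}, \end{aligned}$$ $$\mathcal D_3^-=\mathcal A_1^-\cap\{(0,\mu_2):\mu_2<-\mu_2^{(0)}\},\qquad \mathcal D_3^+=\mathcal A_1^+\cap\{(0,\mu_2):\mu_2>\mu_2^{(0)}\},$$ $$\mathcal D_0^\mp=\mathcal A_0^\mp,\qquad \mathcal D_1^\mp=\mathcal A_1^\mp\setminus\mathcal D_3^\mp,\qquad \mathcal D_2^\mp=\mathcal A_2^\mp,\qquad \mathcal G_{\alpha\beta}=\mathcal D_\alpha^-\cap\mathcal D_\beta^+ .$$ **Theorem.** Let $\mu_1,\mu_2\in\mathbb R$ and let $\alpha,\beta\in\{0,1,2,3\}$ satisfy $\alpha+\beta<3$ or $(\alpha,\beta)\in\{(3,0),(0,3)\}$. If $(\mu_1,\mu_2)\in\mathcal G_{\alpha\beta}$, then for every $K\in\mathbb T^3$ the operator $H_{\mu_1\mu_2}(K)$ has, counted with multiplicity, at least $\alpha$ eigenvalues (strictly) below and at least $\beta$ eigenvalues (strictly) above its essential spectrum. -/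

import Mathlib

noncomputable section

namespace TwoBoson

open MeasureTheory

/-! ### Generalities: essential spectrum, eigenvalues below and above it -/

section General

variable {X : Type*} [NormedAddCommGroup X] [NormedSpace ℂ X]

/-- The (Fredholm) essential spectrum of a bounded operator: the set of all `z` for which
`T - z` is not a Fredholm operator. For a bounded self-adjoint operator on a Hilbert space this
is the spectrum with the isolated eigenvalues of finite multiplicity removed. -/
def essSpectrum (T : X →L[ℂ] X) : Set ℂ :=
  {z | ¬ (T - z • ContinuousLinearMap.id ℂ X).IsFredholm}

/-- The linear span of all eigenvectors of `T` belonging to real eigenvalues that lie strictly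
below the essential spectrum. -/
def spanBelow (T : X →L[ℂ] X) : Submodule ℂ X :=
  ⨆ z ∈ {z : ℝ | ∀ s : ℝ, (s : ℂ) ∈ essSpectrum T → z < s},
    Module.End.eigenspace (T : X →ₗ[ℂ] X) (z : ℂ)

/-- The linear span of all eigenvectors of `T` belonging to real eigenvalues that lie strictly
above the essential spectrum. -/
def spanAbove (T : X →L[ℂ] X) : Submodule ℂ X :=
  ⨆ z ∈ {z : ℝ | ∀ s : ℝ, (s : ℂ) ∈ essSpectrum T → s < z},
    Module.End.eigenspace (T : X →ₗ[ℂ] X) (z : ℂ)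

/-- `T` has at least `n` eigenvalues, counted with multiplicity, below its essential spectrum.
Eigenspaces of different eigenvalues are linearly independent, so the dimension of their span is
the sum of the multiplicities. -/
def HasAtLeastEigenvaluesBelow (T : X →L[ℂ] X) (n : ℕ) : Prop :=
  (n : Cardinal) ≤ Module.rank ℂ (spanBelow T)

/-- `T` has at least `n` eigenvalues, counted with multiplicity, above its essential spectrum. -/
def HasAtLeastEigenvaluesAbove (T : X →L[ℂ] X) (n : ℕ) : Prop :=
  (n : Cardinal) ≤ Module.rank ℂ (spanAbove T)

end General

/-! ### The torus and the space of even square-integrable functions -/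

/-- The fundamental domain `[-π, π)³` of the torus `(ℝ / 2πℤ)³`. -/
def torus : Set (Fin 3 → ℝ) := Set.univ.pi fun _ => Set.Ico (-Real.pi) Real.pi

/-- Lebesgue measure `dp` on the torus. -/
def torusMeasure : Measure (Fin 3 → ℝ) := (volume : Measure (Fin 3 → ℝ)).restrict torus

/-- `L²(𝕋³)`. -/
abbrev L2 : Type := Lp ℂ 2 torusMeasure

theorem torus_subset_Icc :
    torus ⊆ Set.Icc (fun _ => -Real.pi) (fun _ => Real.pi) := by
  intro p hp
  exact ⟨fun i => (hp i trivial).1, fun i => (hp i trivial).2.le⟩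

instance : IsFiniteMeasure torusMeasure := by
  refine ⟨?_⟩
  rw [torusMeasure, Measure.restrict_apply_univ]
  exact (measure_mono torus_subset_Icc).trans_lt measure_Icc_lt_top

theorem torusMeasure_eq :
    torusMeasure = (volume : Measure (Fin 3 → ℝ)).restrict
      (Set.Icc (fun _ => -Real.pi) (fun _ => Real.pi)) := by
  have h : torus =ᵐ[(volume : Measure (Fin 3 → ℝ))]
      Set.Icc (fun _ => -Real.pi) (fun _ => Real.pi) :=
    Measure.univ_pi_Ico_ae_eq_Icc
  exact Measure.restrict_congr_set h

/-- The reflection `p ↦ -p` preserves the measure of the torus. -/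
theorem measurePreserving_neg : MeasurePreserving (fun p : Fin 3 → ℝ => -p)
    torusMeasure torusMeasure := by
  have h := (Measure.measurePreserving_neg (volume : Measure (Fin 3 → ℝ))).restrict_preimage
    (s := Set.Icc (fun _ => -Real.pi) (fun _ => Real.pi)) measurableSet_Icc
  have h2 : Neg.neg ⁻¹' (Set.Icc (fun _ : Fin 3 => -Real.pi) (fun _ => Real.pi)) =
      Set.Icc (fun _ => -Real.pi) (fun _ => Real.pi) := by
    ext p
    simp only [Set.mem_preimage, Set.mem_Icc, Pi.le_def, Pi.neg_apply]
    constructor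
    · rintro ⟨h1, h2⟩
      exact ⟨fun i => by linarith [h2 i], fun i => by linarith [h1 i]⟩
    · rintro ⟨h1, h2⟩
      exact ⟨fun i => by linarith [h2 i], fun i => by linarith [h1 i]⟩
  rw [torusMeasure_eq]
  rw [h2] at h
  exact h

/-- `L^{2,e}(𝕋³)`: the subspace of even functions, `f (-p) = f p` for almost every `p`. -/
def evenL2 : Submodule ℂ L2 where
  carrier := {f | ∀ᵐ p ∂torusMeasure, f (-p) = f p}
  zero_mem' := by
    have h := Lp.coeFn_zero ℂ 2 torusMeasure
    have h' := measurePreserving_neg.quasiMeasurePreserving.ae h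
    filter_upwards [h, h'] with p h1 h2
    simp only [Pi.zero_apply] at h1 h2
    rw [h1, h2]
  add_mem' := by
    intro f g hf hg
    change ∀ᵐ p ∂torusMeasure, f (-p) = f p at hf
    change ∀ᵐ p ∂torusMeasure, g (-p) = g p at hg
    change ∀ᵐ p ∂torusMeasure, (f + g : L2) (-p) = (f + g : L2) p
    have h := Lp.coeFn_add f g
    have h' := measurePreserving_neg.quasiMeasurePreserving.ae h
    filter_upwards [h, h', hf, hg] with p h1 h2 h3 h4
    rw [h1, h2, Pi.add_apply, Pi.add_apply, h3, h4]
  smul_mem' := by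
    intro c f hf
    change ∀ᵐ p ∂torusMeasure, f (-p) = f p at hf
    change ∀ᵐ p ∂torusMeasure, (c • f : L2) (-p) = (c • f : L2) p
    have h := Lp.coeFn_smul c f
    have h' := measurePreserving_neg.quasiMeasurePreserving.ae h
    filter_upwards [h, h', hf] with p h1 h2 h3
    rw [h1, h2, Pi.smul_apply, Pi.smul_apply, h3]

theorem mem_evenL2 {f : L2} : f ∈ evenL2 ↔ ∀ᵐ p ∂torusMeasure, f (-p) = f p := Iff.rfl

/-! ### The operators -/

/-- A bounded continuous real function is an element of every `L^q(𝕋³)`. -/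
theorem memLp_ofReal {φ : (Fin 3 → ℝ) → ℝ} (hφ : Continuous φ) {C : ℝ} (hC : ∀ p, |φ p| ≤ C)
    (q : ENNReal) : MemLp (fun p => (φ p : ℂ)) q torusMeasure :=
  MemLp.of_bound (Complex.continuous_ofReal.comp hφ).aestronglyMeasurable C
    (Filter.Eventually.of_forall fun p => by simpa using hC p)

/-- Multiplication by a bounded continuous real function, as a bounded operator on `L²(𝕋³)`. -/
def mulOp (φ : (Fin 3 → ℝ) → ℝ) (hφ : Continuous φ) (C : ℝ) (hC : ∀ p, |φ p| ≤ C) : L2 →L[ℂ] L2 :=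
  (ContinuousLinearMap.mul ℂ ℂ).holderL torusMeasure ⊤ 2 2 ((memLp_ofReal hφ hC ⊤).toLp _)

theorem mulOp_apply {φ : (Fin 3 → ℝ) → ℝ} (hφ : Continuous φ) {C : ℝ} (hC : ∀ p, |φ p| ≤ C)
    (f : L2) : ∀ᵐ p ∂torusMeasure, mulOp φ hφ C hC f p = φ p * f p := by
  have h1 := (ContinuousLinearMap.mul ℂ ℂ).coeFn_holder (r := 2)
    ((memLp_ofReal hφ hC ⊤).toLp _) f
  have h2 := (memLp_ofReal hφ hC ⊤).coeFn_toLp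
  filter_upwards [h1, h2] with p hp1 hp2
  have h3 : mulOp φ hφ C hC f p =
      (ContinuousLinearMap.mul ℂ ℂ) (((memLp_ofReal hφ hC ⊤).toLp _ : Lp ℂ ⊤ torusMeasure) p)
        (f p) := hp1
  rw [h3, hp2]
  rfl

/-- The rank-one integral operator `f ↦ φ(·) ∫ φ(q) f(q) dq` on `L²(𝕋³)`. -/
def rankOne (φ : (Fin 3 → ℝ) → ℝ) (hφ : Continuous φ) (C : ℝ) (hC : ∀ p, |φ p| ≤ C) :
    L2 →L[ℂ] L2 :=
  (innerSL ℂ ((memLp_ofReal hφ hC 2).toLp _)).smulRight ((memLp_ofReal hφ hC 2).toLp _)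

theorem rankOne_apply {φ : (Fin 3 → ℝ) → ℝ} (hφ : Continuous φ) {C : ℝ} (hC : ∀ p, |φ p| ≤ C)
    (f : L2) : ∀ᵐ p ∂torusMeasure,
      rankOne φ hφ C hC f p = φ p * ∫ q, (φ q : ℂ) * f q ∂torusMeasure := by
  have h2 := (memLp_ofReal hφ hC 2).coeFn_toLp
  have h3 : inner ℂ ((memLp_ofReal hφ hC 2).toLp _ : L2) f
      = ∫ q, (φ q : ℂ) * f q ∂torusMeasure := by
    rw [L2.inner_def]
    refine integral_congr_ae ?_
    filter_upwards [h2] with q hq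
    rw [hq]
    simp [mul_comm]
  have h4 := Lp.coeFn_smul (inner ℂ ((memLp_ofReal hφ hC 2).toLp _ : L2) f)
    ((memLp_ofReal hφ hC 2).toLp _ : L2)
  filter_upwards [h2, h4] with p hp2 hp4
  have h5 : rankOne φ hφ C hC f p = (inner ℂ ((memLp_ofReal hφ hC 2).toLp _ : L2) f •
    ((memLp_ofReal hφ hC 2).toLp _ : L2) : L2) p := rfl
  rw [h5, hp4, Pi.smul_apply, hp2, h3, smul_eq_mul, mul_comm]

/-- The dispersion function `𝓔_K(p) = 4 ∑ᵢ (1 - cos(Kᵢ/2) cos pᵢ)`. -/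
def dispersion (K p : Fin 3 → ℝ) : ℝ := 4 * ∑ i, (1 - Real.cos (K i / 2) * Real.cos (p i))

theorem continuous_dispersion (K : Fin 3 → ℝ) : Continuous (dispersion K) := by
  unfold dispersion
  fun_prop

theorem abs_dispersion_le (K p : Fin 3 → ℝ) : |dispersion K p| ≤ 24 := by
  have h : ∀ i, |Real.cos (K i / 2) * Real.cos (p i)| ≤ 1 := fun i => by
    rw [abs_mul]
    exact mul_le_one₀ (Real.abs_cos_le_one _) (abs_nonneg _) (Real.abs_cos_le_one _)
  have h0 := abs_le.1 (h 0)
  have h1 := abs_le.1 (h 1)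
  have h2 := abs_le.1 (h 2)
  rw [dispersion, Fin.sum_univ_three, abs_le]
  constructor <;> linarith [h0.1, h0.2, h1.1, h1.2, h2.1, h2.2]

/-- The free operator `H₀(K)`, on all of `L²(𝕋³)`. -/
def freeOp (K : Fin 3 → ℝ) : L2 →L[ℂ] L2 :=
  mulOp (dispersion K) (continuous_dispersion K) 24 (abs_dispersion_le K)

theorem continuous_cosCoord (i : Fin 3) : Continuous fun p : Fin 3 → ℝ => Real.cos (p i) := by
  fun_prop

/-- The interaction
`(V f)(p) = μ₁/(2π)³ ∫ f(q) dq + 2μ₂/(2π)³ ∑ᵢ cos pᵢ ∫ cos qᵢ f(q) dq`, on all of `L²(𝕋³)`. -/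
def interaction (μ₁ μ₂ : ℝ) : L2 →L[ℂ] L2 :=
  ((μ₁ / (2 * Real.pi) ^ 3 : ℝ) : ℂ) •
      rankOne (fun _ => 1) continuous_const 1 (fun _ => by simp) +
    ((2 * μ₂ / (2 * Real.pi) ^ 3 : ℝ) : ℂ) •
      ∑ i : Fin 3, rankOne (fun p => Real.cos (p i)) (continuous_cosCoord i) 1
        (fun p => Real.abs_cos_le_one (p i))

theorem fullHamiltonian_apply (μ₁ μ₂ : ℝ) (K : Fin 3 → ℝ) (f : L2) :
    ∀ᵐ p ∂torusMeasure, (freeOp K + interaction μ₁ μ₂) f p =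
      dispersion K p * f p + ((μ₁ / (2 * Real.pi) ^ 3 : ℝ) : ℂ) * ∫ q, f q ∂torusMeasure +
        ((2 * μ₂ / (2 * Real.pi) ^ 3 : ℝ) : ℂ) * ∑ i : Fin 3,
          (Real.cos (p i) : ℂ) * ∫ q, (Real.cos (q i) : ℂ) * f q ∂torusMeasure := by
  let R0 : L2 →L[ℂ] L2 := rankOne (fun _ => 1) continuous_const 1 (fun _ => by simp)
  let R : Fin 3 → L2 →L[ℂ] L2 := fun i => rankOne (fun p => Real.cos (p i))
    (continuous_cosCoord i) 1 (fun p => Real.abs_cos_le_one (p i))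
  let c₁ : ℂ := ((μ₁ / (2 * Real.pi) ^ 3 : ℝ) : ℂ)
  let c₂ : ℂ := ((2 * μ₂ / (2 * Real.pi) ^ 3 : ℝ) : ℂ)
  have e : (freeOp K + interaction μ₁ μ₂) f =
      freeOp K f + (c₁ • R0 f + c₂ • (R 0 f + R 1 f + R 2 f)) := by
    rw [interaction, Fin.sum_univ_three]
    rfl
  have hF := mulOp_apply (continuous_dispersion K) (abs_dispersion_le K) f
  have h0 : ∀ᵐ p ∂torusMeasure, R0 f p = _ :=
    rankOne_apply (φ := fun _ => 1) continuous_const (C := 1) (fun _ => by simp) f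
  have hR : ∀ i, ∀ᵐ p ∂torusMeasure, R i f p = _ := fun i =>
    rankOne_apply (continuous_cosCoord i) (fun p => Real.abs_cos_le_one (p i)) f
  rw [e]
  filter_upwards [hF, h0, hR 0, hR 1, hR 2, Lp.coeFn_add (freeOp K f)
      (c₁ • R0 f + c₂ • (R 0 f + R 1 f + R 2 f)),
    Lp.coeFn_add (c₁ • R0 f) (c₂ • (R 0 f + R 1 f + R 2 f)), Lp.coeFn_smul c₁ (R0 f),
    Lp.coeFn_smul c₂ (R 0 f + R 1 f + R 2 f), Lp.coeFn_add (R 0 f + R 1 f) (R 2 f),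
    Lp.coeFn_add (R 0 f) (R 1 f)] with p a1 a2 a3 a4 a5 a6 a7 a8 a9 a10 a11
  rw [a6, Pi.add_apply, a7, Pi.add_apply, a8, Pi.smul_apply, a9, Pi.smul_apply, a10,
    Pi.add_apply, a11, Pi.add_apply, a2, a3, a4, a5, Fin.sum_univ_three]
  have a1' : freeOp K f p = dispersion K p * f p := a1
  rw [a1']
  simp only [Complex.ofReal_one, one_mul, smul_eq_mul]
  ring

theorem fullHamiltonian_mem (μ₁ μ₂ : ℝ) (K : Fin 3 → ℝ) :
    ∀ f ∈ evenL2, (freeOp K + interaction μ₁ μ₂) f ∈ evenL2 := by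
  intro f hf
  have h := fullHamiltonian_apply μ₁ μ₂ K f
  have h' := measurePreserving_neg.quasiMeasurePreserving.ae h
  rw [mem_evenL2] at hf ⊢
  filter_upwards [h, h', hf] with p h1 h2 h3
  rw [h1, h2, h3]
  simp only [dispersion, Pi.neg_apply, Real.cos_neg]

/-- The two-boson lattice Schrödinger operator `H_{μ₁μ₂}(K) = H₀(K) + V_{μ₁μ₂}` acting on
`L^{2,e}(𝕋³)`. -/
def hamiltonian (μ₁ μ₂ : ℝ) (K : Fin 3 → ℝ) : evenL2 →L[ℂ] evenL2 :=
  (freeOp K + interaction μ₁ μ₂).restrict (fullHamiltonian_mem μ₁ μ₂ K)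

/-! ### The regions of the coupling plane -/

/-- `a₁₁ˢ(0) = ∫ α₁ˢ(p)² / 𝓔₀(p) dp` with `α₁ˢ = 1/√(8π³)`. -/
def a11 : ℝ :=
  ∫ p, (1 / Real.sqrt (8 * Real.pi ^ 3)) ^ 2 / dispersion 0 p ∂torusMeasure

/-- `a^{a₁₂}(0) = ∫ α₃^{a₁₂}(p)² / 𝓔₀(p) dp` with `α₃^{a₁₂}(p) = (cos p₁ - cos p₂)/√(8π³)`. -/
def aA12 : ℝ :=
  ∫ p, ((Real.cos (p 0) - Real.cos (p 1)) / Real.sqrt (8 * Real.pi ^ 3)) ^ 2 / dispersion 0 p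
    ∂torusMeasure

/-- `μ₀ = 24 a₁₁ˢ(0) / (12 a₁₁ˢ(0) - 1)`. -/
def mu0 : ℝ := 24 * a11 / (12 * a11 - 1)

/-- `μ₂⁽⁰⁾ = 1 / a^{a₁₂}(0)`. -/
def mu2crit : ℝ := 1 / aA12

/-- `μ₂⁻(μ₁) = 24/(μ₁ + 12) - μ₀`, used only for `μ₁ ≠ -12`. -/
def mu2Minus (μ₁ : ℝ) : ℝ := 24 / (μ₁ + 12) - mu0

/-- `μ₂⁺(μ₁) = 24/(μ₁ - 12) + μ₀`, used only for `μ₁ ≠ 12`. -/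
def mu2Plus (μ₁ : ℝ) : ℝ := 24 / (μ₁ - 12) + mu0

/-- The regions `𝒜⁻_ζ`, `ζ = 0, 1, 2`. -/
def AMinus : ℕ → Set (ℝ × ℝ)
  | 0 => {m | -12 < m.1 ∧ mu2Minus m.1 < m.2}
  | 1 => {m | -12 < m.1 ∧ m.2 < mu2Minus m.1} ∪ {m | m.1 = -12} ∪
      {m | m.1 < -12 ∧ mu2Minus m.1 < m.2}
  | 2 => {m | m.1 < -12 ∧ m.2 < mu2Minus m.1}
  | _ => ∅

/-- The regions `𝒜⁺_ζ`, `ζ = 0, 1, 2`. -/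
def APlus : ℕ → Set (ℝ × ℝ)
  | 0 => {m | m.1 < 12 ∧ m.2 < mu2Plus m.1}
  | 1 => {m | m.1 < 12 ∧ mu2Plus m.1 < m.2} ∪ {m | m.1 = 12} ∪
      {m | 12 < m.1 ∧ m.2 < mu2Plus m.1}
  | 2 => {m | 12 < m.1 ∧ mu2Plus m.1 < m.2}
  | _ => ∅

/-- The interval `ℬ⁻₁ = (-∞, -μ₂⁽⁰⁾)`. -/
def BMinus1 : Set ℝ := {x | x < -mu2crit}

/-- The interval `ℬ⁺₁ = (μ₂⁽⁰⁾, ∞)`. -/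
def BPlus1 : Set ℝ := {x | mu2crit < x}

/-- The region `𝒟⁻₃ = 𝒜⁻₁ ∩ {(0, μ₂) : μ₂ ∈ ℬ⁻₁}`. -/
def DMinus3 : Set (ℝ × ℝ) := AMinus 1 ∩ {m | m.1 = 0 ∧ m.2 ∈ BMinus1}

/-- The region `𝒟⁺₃ = 𝒜⁺₁ ∩ {(0, μ₂) : μ₂ ∈ ℬ⁺₁}`. -/
def DPlus3 : Set (ℝ × ℝ) := APlus 1 ∩ {m | m.1 = 0 ∧ m.2 ∈ BPlus1}

/-- The regions `𝒟⁻_ζ`, `ζ = 0, 1, 2, 3`. -/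
def DMinus : ℕ → Set (ℝ × ℝ)
  | 0 => AMinus 0
  | 1 => AMinus 1 \ DMinus3
  | 2 => AMinus 2
  | 3 => DMinus3
  | _ => ∅

/-- The regions `𝒟⁺_ζ`, `ζ = 0, 1, 2, 3`. -/
def DPlus : ℕ → Set (ℝ × ℝ)
  | 0 => APlus 0
  | 1 => APlus 1 \ DPlus3
  | 2 => APlus 2
  | 3 => DPlus3
  | _ => ∅

/-- `𝒢_{αβ} = 𝒟⁻_α ∩ 𝒟⁺_β`. -/
def G (α β : ℕ) : Set (ℝ × ℝ) := DMinus α ∩ DPlus β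

end TwoBoson

end

/-
The idea. By a Weyl-type argument everything below the bottom `m` of the dispersion function `𝓔_K`
is discrete spectrum, because `H_{μ₁μ₂}(K)` is a finite-rank perturbation of multiplication by
`𝓔_K`. By the min-max principle it therefore suffices to find an `n`-dimensional space of trial
functions on which the quadratic form of `H_{μ₁μ₂}(K)` lies strictly below `m`.

Shifting each `pᵢ` by `0` or `π` turns `𝓔_K` into a function which is at most `m + 𝓔₀`, and leaves
the interaction unchanged up to the signs of the `cos pᵢ`, which enter it quadratically. Hence it
is enough to make the form of `𝓔₀ + V` negative, independently of `K`. Permutation-symmetric trial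
functions `x + (𝓔₀ + ε)⁻¹` and `1` produce, as `ε → 0`, the hyperbola `μ₂⁻` and the line
`μ₁ = -12`; the functions `∑ᵢ uᵢ cos pᵢ · (𝓔₀ + ε)⁻¹` with `∑ᵢ uᵢ = 0` are orthogonal to all
symmetric ones and produce two further negative directions once `μ₂ < -μ₂⁽⁰⁾`.

Replacing `K` by `K + (2π, 2π, 2π)` turns `𝓔_K` into `24 - 𝓔_K`, which exchanges the spectrum
above with the spectrum below and `(μ₁, μ₂)` with `(-μ₁, -μ₂)`.
-/

noncomputable section

namespace TwoBoson

open MeasureTheory Filter Topology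

section Variational

open scoped LinearMap.FiniteRangeSetoid

variable {X : Type*} [NormedAddCommGroup X] [InnerProductSpace ℂ X]

theorem reApplyInnerSelf_sub_smul_id (T : X →L[ℂ] X) (s : ℝ) (x : X) :
    (T - (s : ℂ) • ContinuousLinearMap.id ℂ X).reApplyInnerSelf x =
      T.reApplyInnerSelf x - s * ‖x‖ ^ 2 := by
  rw [ContinuousLinearMap.reApplyInnerSelf_apply, ContinuousLinearMap.reApplyInnerSelf_apply,
    sub_apply, smul_apply, ContinuousLinearMap.id_apply, inner_sub_left, inner_smul_left,
    inner_self_eq_norm_sq_to_K]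
  simp [← Complex.ofReal_pow]

theorem inner_map_sum_smul_sum_smul {ι : Type*} [Fintype ι] {B : X →L[ℂ] X} {v : ι → X}
    (hoff : ∀ i j, i ≠ j → inner ℂ (B (v i)) (v j) = 0) (c : ι → ℂ) :
    inner ℂ (B (∑ i, c i • v i)) (∑ i, c i • v i) =
      ∑ i, ((‖c i‖ ^ 2 : ℝ) : ℂ) * inner ℂ (B (v i)) (v i) := by
  simp only [map_sum, map_smul, sum_inner, inner_sum, inner_smul_left, inner_smul_right]
  refine Finset.sum_congr rfl fun i _ => ?_
  rw [Finset.sum_eq_single i (fun j _ hj => by rw [hoff j i hj]; ring) (by simp), ← mul_assoc,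
    Complex.mul_conj, Complex.normSq_eq_norm_sq]

theorem reApplyInnerSelf_sum_smul_neg {ι : Type*} [Fintype ι] {B : X →L[ℂ] X} {v : ι → X}
    (hoff : ∀ i j, i ≠ j → inner ℂ (B (v i)) (v j) = 0)
    (hdiag : ∀ i, B.reApplyInnerSelf (v i) < 0) {c : ι → ℂ} (hc : c ≠ 0) :
    B.reApplyInnerSelf (∑ i, c i • v i) < 0 := by
  obtain ⟨i, hi⟩ := Function.ne_iff.1 hc
  rw [ContinuousLinearMap.reApplyInnerSelf_apply, inner_map_sum_smul_sum_smul hoff, map_sum]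
  simp only [RCLike.re_eq_complex_re, Complex.re_ofReal_mul]
  exact Finset.sum_neg'
    (fun j _ => mul_nonpos_of_nonneg_of_nonpos (by positivity) (hdiag j).le)
    ⟨i, Finset.mem_univ i, mul_neg_of_pos_of_neg (pow_pos (norm_pos_iff.2 hi) 2) (hdiag i)⟩

theorem isFredholm_of_isUnit_of_hasFiniteRange {A B : X →L[ℂ] X} (hB : IsUnit B)
    (h : (A - B).toLinearMap.HasFiniteRange) : A.IsFredholm := by
  obtain ⟨u, rfl⟩ := hB
  refine .of_isQuasiInverse (v := (↑u⁻¹ : X →L[ℂ] X)) ?_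
  refine (LinearMap.isQuasiInverse_congr (Setoid.refl _) ?_).1
    (ContinuousLinearEquiv.unitsEquiv ℂ X u).toLinearEquiv.isQuasiInverse
  exact LinearMap.FiniteRangeSetoid.equiv_iff_hasFiniteRange.2 h

variable {T M : X →L[ℂ] X} {m : ℝ}

/-- The span of all eigenvectors of `T` with real eigenvalue below `m`, to be compared with
`spanBelow T`. -/
def spectralSpan (T : X →L[ℂ] X) (m : ℝ) : Submodule ℂ X :=
  ⨆ z ∈ {z : ℝ | z < m}, Module.End.eigenspace (T : X →ₗ[ℂ] X) (z : ℂ)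

theorem mem_spectralSpan {z : ℝ} (hz : z < m) {x : X} (hx : T x = (z : ℂ) • x) :
    x ∈ spectralSpan T m :=
  le_biSup (i := z) (s := {z : ℝ | z < m})
    (fun z : ℝ => Module.End.eigenspace (T : X →ₗ[ℂ] X) (z : ℂ)) hz
    (Module.End.mem_eigenspace_iff.2 hx)

theorem map_mem_spectralSpan {x : X} (hx : x ∈ spectralSpan T m) : T x ∈ spectralSpan T m := by
  have : spectralSpan T m ≤ (spectralSpan T m).comap (T : X →ₗ[ℂ] X) :=
    iSup₂_le fun z hz y hy => by
      have hTy : T y = (z : ℂ) • y := Module.End.mem_eigenspace_iff.1 hy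
      rw [Submodule.mem_comap, ContinuousLinearMap.coe_coe, hTy]
      exact Submodule.smul_mem _ _ (mem_spectralSpan hz hTy)
  exact this hx

variable [CompleteSpace X]

theorem isUnit_sub_smul_id_of_lt {s : ℝ} (hs : s < m)
    (hM : ∀ x, m * ‖x‖ ^ 2 ≤ M.reApplyInnerSelf x) :
    IsUnit (M - (s : ℂ) • ContinuousLinearMap.id ℂ X) := by
  refine ContinuousLinearMap.isUnit_of_forall_le_norm_inner_map _
    (c := ⟨m - s, (sub_pos.2 hs).le⟩) (sub_pos.2 hs) fun x => ?_
  calc ‖x‖ ^ 2 * (m - s) ≤ (M - (s : ℂ) • ContinuousLinearMap.id ℂ X).reApplyInnerSelf x := by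
        rw [reApplyInnerSelf_sub_smul_id]
        linarith [hM x]
    _ ≤ ‖inner ℂ ((M - (s : ℂ) • ContinuousLinearMap.id ℂ X) x) x‖ := Complex.re_le_norm _

theorem isFredholm_sub_smul_id_of_lt (hV : (T - M).toLinearMap.HasFiniteRange)
    (hM : ∀ x, m * ‖x‖ ^ 2 ≤ M.reApplyInnerSelf x) {s : ℝ} (hs : s < m) :
    (T - (s : ℂ) • ContinuousLinearMap.id ℂ X).IsFredholm :=
  isFredholm_of_isUnit_of_hasFiniteRange (isUnit_sub_smul_id_of_lt hs hM) (by simpa using hV)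

theorem isUnit_of_isSelfAdjoint_of_isFredholm (hT : IsSelfAdjoint T) (hF : T.IsFredholm)
    (hker : T.ker = ⊥) : IsUnit T := by
  have hcomplete : IsComplete (T.range : Set X) := hF.isClosed_range.isComplete
  have : CompleteSpace T.range := hcomplete.completeSpace_coe
  have hrange : T.range = ⊤ := by
    rw [← Submodule.orthogonal_eq_bot_iff, ContinuousLinearMap.orthogonal_range, hT.adjoint_eq,
      hker]
  exact ContinuousLinearMap.isUnit_iff_bijective.2
    ⟨LinearMap.ker_eq_bot.1 hker, LinearMap.range_eq_top.1 hrange⟩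

theorem le_reApplyInnerSelf_of_forall_eigenvalue_ge (hT : IsSelfAdjoint T)
    (hV : (T - M).toLinearMap.HasFiniteRange) (hM : ∀ x, m * ‖x‖ ^ 2 ≤ M.reApplyInnerSelf x)
    (heig : ∀ s : ℝ, Module.End.HasEigenvalue (T : X →ₗ[ℂ] X) s → m ≤ s) (x : X) :
    m * ‖x‖ ^ 2 ≤ T.reApplyInnerSelf x := by
  have hspec : ∀ s ∈ spectrum ℝ T, m ≤ s := by
    intro s hs
    by_contra! hsm
    have hA : IsSelfAdjoint (T - (s : ℂ) • ContinuousLinearMap.id ℂ X) :=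
      hT.sub ((isSelfAdjoint_iff.2 (Complex.conj_ofReal s)).smul (.one _))
    refine hs (IsUnit.sub_iff.1 ?_)
    refine isUnit_of_isSelfAdjoint_of_isFredholm hA (isFredholm_sub_smul_id_of_lt hV hM hsm) ?_
    by_contra hker
    refine hsm.not_ge (heig s ?_)
    rwa [Module.End.hasEigenvalue_iff, Module.End.eigenspace_def]
  have hle : algebraMap ℝ (X →L[ℂ] X) m ≤ T := algebraMap_le_of_le_spectrum hspec
  have := (ContinuousLinearMap.le_def _ _).1 hle |>.2 x
  have := reApplyInnerSelf_sub_smul_id T m x ▸ this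
  linarith

theorem spectralSpan_le_spanBelow (hV : (T - M).toLinearMap.HasFiniteRange)
    (hM : ∀ x, m * ‖x‖ ^ 2 ≤ M.reApplyInnerSelf x) : spectralSpan T m ≤ spanBelow T := by
  refine biSup_mono fun z hz s hs => ?_
  by_contra! hsz
  exact hs (isFredholm_sub_smul_id_of_lt hV hM (hsz.trans_lt hz))

theorem starProjection_apply_of_forall_map_mem (hT : IsSelfAdjoint T) {S : Submodule ℂ X}
    [S.HasOrthogonalProjection] (hS : ∀ x ∈ S, T x ∈ S) (x : X) :
    S.starProjection (T x) = T (S.starProjection x) := by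
  refine Submodule.eq_starProjection_of_mem_of_inner_eq_zero
    (hS _ (S.starProjection_apply_mem x)) fun y hy => ?_
  rw [← map_sub, ← ContinuousLinearMap.adjoint_inner_right, hT.adjoint_eq]
  exact Submodule.starProjection_inner_eq_zero _ _ (hS y hy)

theorem isSelfAdjoint_comp_starProjection (hT : IsSelfAdjoint T) {S : Submodule ℂ X}
    [S.HasOrthogonalProjection] (hS : ∀ x ∈ S, T x ∈ S) :
    IsSelfAdjoint (T ∘L S.starProjection) := by
  have hcomm : T * S.starProjection = S.starProjection * T :=
    ContinuousLinearMap.ext fun x => (starProjection_apply_of_forall_map_mem hT hS x).symm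
  exact (hT.commute_iff (isSelfAdjoint_starProjection S)).1 hcomm

-- Replacing `T` by `m` on `spectralSpan T m` removes all eigenvalues below `m`.
theorem le_of_hasEigenvalue_sub_comp_starProjection (hT : IsSelfAdjoint T)
    [(spectralSpan T m).HasOrthogonalProjection] {s : ℝ}
    (hs : Module.End.HasEigenvalue
      ((T - (T - (m : ℂ) • ContinuousLinearMap.id ℂ X) ∘L (spectralSpan T m).starProjection :
        X →L[ℂ] X) : X →ₗ[ℂ] X) s) : m ≤ s := by
  obtain ⟨y, hy, hy0⟩ := hs.exists_hasEigenvector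
  set P := (spectralSpan T m).starProjection
  have hy : T y - (T (P y) - (m : ℂ) • P y) = (s : ℂ) • y := Module.End.mem_eigenspace_iff.1 hy
  by_contra! hsm
  have hPy : P y = 0 := by
    have hPP : P (P y) = P y := Submodule.starProjection_eq_self_iff.2 (Submodule.coe_mem _)
    have h := congrArg P hy
    rw [map_sub, map_sub, map_smul, map_smul,
      starProjection_apply_of_forall_map_mem hT fun y => map_mem_spectralSpan,
      starProjection_apply_of_forall_map_mem hT fun y => map_mem_spectralSpan, hPP,
      sub_sub_cancel, ← sub_eq_zero, ← sub_smul] at h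
    exact (smul_eq_zero.1 h).resolve_left (by exact_mod_cast (sub_pos.2 hsm).ne')
  rw [hPy, map_zero, smul_zero, sub_zero, sub_zero] at hy
  rw [Submodule.starProjection_eq_self_iff.2 (mem_spectralSpan hsm hy)] at hPy
  exact hy0 hPy

theorem le_reApplyInnerSelf_of_mem_orthogonal (hT : IsSelfAdjoint T)
    (hV : (T - M).toLinearMap.HasFiniteRange) (hM : ∀ x, m * ‖x‖ ^ 2 ≤ M.reApplyInnerSelf x)
    [FiniteDimensional ℂ (spectralSpan T m)] {x : X} (hx : x ∈ (spectralSpan T m)ᗮ) :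
    m * ‖x‖ ^ 2 ≤ T.reApplyInnerSelf x := by
  set S := spectralSpan T m
  set A : X →L[ℂ] X := T - (m : ℂ) • ContinuousLinearMap.id ℂ X
  have hA : IsSelfAdjoint A :=
    hT.sub ((isSelfAdjoint_iff.2 (Complex.conj_ofReal m)).smul (.one _))
  have hAS : ∀ y ∈ S, A y ∈ S := fun y hy =>
    S.sub_mem (map_mem_spectralSpan hy) (S.smul_mem _ hy)
  have hfin : (T - A ∘L S.starProjection - M).toLinearMap.HasFiniteRange := by
    have hP : S.starProjection.toLinearMap.HasFiniteRange := by
      rw [LinearMap.hasFiniteRange_iff_range, S.range_starProjection]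
      exact Module.Finite.iff_fg.1 inferInstance
    rw [sub_right_comm]
    exact hV.sub (hP.comp_left A.toLinearMap)
  have h := le_reApplyInnerSelf_of_forall_eigenvalue_ge
    (hT.sub (isSelfAdjoint_comp_starProjection hA hAS)) hfin hM
    (fun s => le_of_hasEigenvalue_sub_comp_starProjection hT) x
  rwa [ContinuousLinearMap.reApplyInnerSelf_apply, sub_apply, ContinuousLinearMap.comp_apply,
    (S.starProjection_apply_eq_zero_iff).2 hx, map_zero, sub_zero] at h

theorem hasAtLeastEigenvaluesBelow_of_form_lt (hT : IsSelfAdjoint T)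
    (hV : (T - M).toLinearMap.HasFiniteRange) (hM : ∀ x, m * ‖x‖ ^ 2 ≤ M.reApplyInnerSelf x)
    {n : ℕ} (v : Fin n → X)
    (hv : ∀ c : Fin n → ℂ, c ≠ 0 →
      T.reApplyInnerSelf (∑ i, c i • v i) < m * ‖∑ i, c i • v i‖ ^ 2) :
    HasAtLeastEigenvaluesBelow T n := by
  set S := spectralSpan T m
  refine le_trans ?_ (Submodule.rank_mono (spectralSpan_le_spanBelow hV hM))
  by_contra! hlt
  have : FiniteDimensional ℂ S :=
    Module.rank_lt_aleph0_iff.1 (hlt.trans Cardinal.natCast_lt_aleph0)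
  have hfin : Module.finrank ℂ S < Module.finrank ℂ (Fin n → ℂ) := by
    rw [Module.finrank_fin_fun]
    exact_mod_cast Module.finrank_eq_rank ℂ S ▸ hlt
  obtain ⟨c, hc, hc0⟩ := (Submodule.ne_bot_iff _).1 <| LinearMap.ker_ne_bot_of_finrank_lt
    (f := S.orthogonalProjectionOnto.toLinearMap ∘ₗ Fintype.linearCombination ℂ v) hfin
  have hw : ∑ i, c i • v i ∈ Sᗮ := Submodule.orthogonalProjectionOnto_eq_zero_iff.1 hc
  exact (hv c hc0).not_ge (le_reApplyInnerSelf_of_mem_orthogonal hT hV hM hw)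

end Variational

section Negation

variable {X : Type*} [NormedAddCommGroup X] [NormedSpace ℂ X] {T : X →L[ℂ] X}

theorem isFredholm_neg (hT : T.IsFredholm) : (-T).IsFredholm := by
  obtain ⟨S, hS⟩ := hT.exists_isQuasiInverse
  refine .of_isQuasiInverse (v := -S) ?_
  rw [LinearMap.IsQuasiInverse, LinearMap.IsLeftQuasiInverse, LinearMap.IsRightQuasiInverse] at hS ⊢
  simpa [LinearMap.comp_neg, LinearMap.neg_comp] using hS

theorem sub_mem_essSpectrum_sub {z : ℂ} (hz : z ∈ essSpectrum T) (c : ℂ) :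
    c - z ∈ essSpectrum (c • ContinuousLinearMap.id ℂ X - T) := by
  intro h
  refine hz ?_
  convert isFredholm_neg h using 1
  rw [sub_smul]
  abel

theorem spanBelow_sub_le_spanAbove (c : ℝ) :
    spanBelow ((c : ℂ) • ContinuousLinearMap.id ℂ X - T) ≤ spanAbove T := by
  refine iSup₂_le fun z hz x hx => ?_
  have hmem : c - z ∈ {w : ℝ | ∀ s : ℝ, (s : ℂ) ∈ essSpectrum T → s < w} := fun s hs => by
    have := hz (c - s) (by simpa using sub_mem_essSpectrum_sub hs c)
    linarith
  have hx : (c : ℂ) • x - T x = (z : ℂ) • x := Module.End.mem_eigenspace_iff.1 hx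
  refine le_biSup (i := c - z) (fun w : ℝ => Module.End.eigenspace (T : X →ₗ[ℂ] X) (w : ℂ)) hmem
    (Module.End.mem_eigenspace_iff.2 ?_)
  rw [ContinuousLinearMap.coe_coe, Complex.ofReal_sub, sub_smul, ← hx, sub_sub_cancel]

theorem hasAtLeastEigenvaluesAbove_of_below_sub {c : ℝ} {n : ℕ}
    (h : HasAtLeastEigenvaluesBelow ((c : ℂ) • ContinuousLinearMap.id ℂ X - T) n) :
    HasAtLeastEigenvaluesAbove T n :=
  h.trans (Submodule.rank_mono (spanBelow_sub_le_spanAbove c))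

end Negation

section CosineCube

open Real

/-- The cube `[-1, 1]³` of possible values of the vector `(cos p₁, cos p₂, cos p₃)`. -/
abbrev CosCube : Type := Fin 3 → Set.Icc (-1 : ℝ) 1

/-- The map `p ↦ (cos (pᵢ + θᵢ))ᵢ` from momenta to the cube. The shift `θ`, with entries `0` or `π`,
absorbs the signs of the factors `cos (Kᵢ / 2)` in the dispersion function. -/
def cosMap (θ p : Fin 3 → ℝ) : CosCube :=
  fun i => ⟨cos (p i + θ i), cos_mem_Icc _⟩

theorem continuous_cosMap (θ : Fin 3 → ℝ) : Continuous (cosMap θ) := by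
  unfold cosMap
  fun_prop

/-- The cosine as a map from the circle `ℝ / 2πℤ` to `[-1, 1]`. -/
def circleCos (φ : AddCircle (2 * π)) : Set.Icc (-1 : ℝ) 1 :=
  ⟨Real.Angle.cos φ, by induction φ using Real.Angle.induction_on with | h t => exact cos_mem_Icc t⟩

theorem continuous_circleCos : Continuous circleCos :=
  Real.Angle.continuous_cos.subtype_mk _

local instance : Fact (0 < 2 * π) := ⟨two_pi_pos⟩

/-- The distribution of `cos t` for `t` in the circle `ℝ / 2πℤ` with its Lebesgue measure (of total
mass `2π`), i.e. the measure with density `2 / √(1 - x²)` on `[-1, 1]`. -/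
def arcsineMeasure : Measure (Set.Icc (-1 : ℝ) 1) := volume.map circleCos

instance : IsFiniteMeasure arcsineMeasure := by
  unfold arcsineMeasure
  infer_instance

/-- The distribution of `(cos p₁, cos p₂, cos p₃)` for `p` in the torus, of total mass `(2π)³`. -/
def cubeMeasure : Measure CosCube := Measure.pi fun _ => arcsineMeasure

instance : IsFiniteMeasure cubeMeasure := by
  unfold cubeMeasure
  infer_instance

theorem measurePreserving_cos_add (θ : ℝ) :
    MeasurePreserving (fun t => (⟨cos (t + θ), cos_mem_Icc _⟩ : Set.Icc (-1 : ℝ) 1))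
      (volume.restrict (Set.Ico (-π) π)) arcsineMeasure := by
  have hcos : MeasurePreserving circleCos volume arcsineMeasure :=
    ⟨continuous_circleCos.measurable, rfl⟩
  have hmk := AddCircle.measurePreserving_mk (2 * π) (-π)
  rw [show -π + 2 * π = π by ring, Measure.restrict_congr_set Ico_ae_eq_Ioc.symm] at hmk
  exact (hcos.comp (measurePreserving_add_right volume (θ : AddCircle (2 * π)))).comp hmk

theorem measurePreserving_cosMap (θ : Fin 3 → ℝ) :
    MeasurePreserving (cosMap θ) torusMeasure cubeMeasure := by
  rw [torusMeasure, torus, volume_pi, Measure.restrict_pi_pi]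
  exact measurePreserving_pi _ _ fun i => measurePreserving_cos_add (θ i)

theorem integral_comp_cosMap {F : CosCube → ℝ} (hF : Measurable F) (θ : Fin 3 → ℝ) :
    ∫ p, F (cosMap θ p) ∂torusMeasure = ∫ x, F x ∂cubeMeasure := by
  rw [← (measurePreserving_cosMap θ).map_eq,
    integral_map (continuous_cosMap θ).measurable.aemeasurable hF.aestronglyMeasurable]

theorem integrable_cubeMeasure (F : C(CosCube, ℝ)) : Integrable F cubeMeasure :=
  F.continuous.integrable_of_hasCompactSupport (.of_compactSpace F)

/-- The mean of a continuous function of `(cos p₁, cos p₂, cos p₃)` over the torus. -/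
def cubeMean : C(CosCube, ℝ) →ₗ[ℝ] ℝ where
  toFun F := ((2 * π) ^ 3)⁻¹ * ∫ x, F x ∂cubeMeasure
  map_add' F G := by
    simp only [ContinuousMap.add_apply]
    rw [integral_add (integrable_cubeMeasure F) (integrable_cubeMeasure G), mul_add]
  map_smul' c F := by
    simp only [ContinuousMap.smul_apply, smul_eq_mul, RingHom.id_apply]
    rw [integral_const_mul, mul_left_comm]

theorem cubeMean_apply (F : C(CosCube, ℝ)) :
    cubeMean F = ((2 * π) ^ 3)⁻¹ * ∫ x, F x ∂cubeMeasure := rfl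

theorem cubeMean_mono {F G : C(CosCube, ℝ)} (h : F ≤ G) : cubeMean F ≤ cubeMean G :=
  mul_le_mul_of_nonneg_left
    (integral_mono (integrable_cubeMeasure F) (integrable_cubeMeasure G) h) (by positivity)

/-- The coordinate function `cos pᵢ` on the cube. -/
def coord (i : Fin 3) : C(CosCube, ℝ) := ⟨fun x => x i, by fun_prop⟩

@[simp] theorem coord_apply (i : Fin 3) (x : CosCube) : coord i x = x i := rfl

theorem integral_pow_arcsineMeasure (n : ℕ) :
    ∫ x, (x : ℝ) ^ n ∂arcsineMeasure = ∫ t in (-π)..π, cos t ^ n := by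
  have h := measurePreserving_cos_add 0
  rw [← h.map_eq, integral_map h.measurable.aemeasurable (by fun_prop),
    intervalIntegral.integral_of_le (by linarith [pi_pos]), integral_Ico_eq_integral_Ioc]
  simp only [add_zero]

theorem cubeMean_prod_coord_pow (n : Fin 3 → ℕ) :
    cubeMean (∏ i, coord i ^ n i) = ∏ i, (2 * π)⁻¹ * ∫ t in (-π)..π, cos t ^ n i := by
  have h := integral_fintype_prod_eq_prod (𝕜 := ℝ) (μ := fun _ : Fin 3 => arcsineMeasure)
    fun i (x : Set.Icc (-1 : ℝ) 1) => (x : ℝ) ^ n i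
  simp only [integral_pow_arcsineMeasure] at h
  simp only [cubeMean_apply, cubeMeasure, ContinuousMap.coe_prod, Finset.prod_apply,
    ContinuousMap.pow_apply, coord_apply, h, Finset.prod_mul_distrib, Finset.prod_const,
    Finset.card_fin, inv_pow]

theorem cubeMean_one : cubeMean 1 = 1 := by
  have h := cubeMean_prod_coord_pow 0
  have hpi : (2 * π)⁻¹ * (π + π) = 1 := by field_simp; ring
  simpa [hpi, -mul_inv_rev] using h

/-- The action of a permutation of the coordinates on continuous functions on the cube. -/
def permute (e : Equiv.Perm (Fin 3)) : C(CosCube, ℝ) →ₐ[ℝ] C(CosCube, ℝ) :=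
  ContinuousMap.compRightAlgHom ℝ ℝ ⟨fun x => x ∘ e, by fun_prop⟩

theorem permute_apply (e : Equiv.Perm (Fin 3)) (F : C(CosCube, ℝ)) (x : CosCube) :
    permute e F x = F (x ∘ e) := rfl

theorem permute_coord (e : Equiv.Perm (Fin 3)) (i : Fin 3) :
    permute e (coord i) = coord (e i) := rfl

theorem cubeMean_permute (e : Equiv.Perm (Fin 3)) (F : C(CosCube, ℝ)) :
    cubeMean (permute e F) = cubeMean F := by
  have h :=
    (measurePreserving_piCongrLeft (fun _ : Fin 3 => arcsineMeasure) e.symm).integral_comp' F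
  rw [cubeMean_apply, cubeMean_apply, cubeMeasure, ← h]
  congr 2 with x
  refine congrArg F (funext fun i => ?_)
  have h := MeasurableEquiv.piCongrLeft_apply_apply (β := fun _ : Fin 3 => Set.Icc (-1 : ℝ) 1)
    e.symm x (e i)
  rwa [Equiv.symm_apply_apply, eq_comm] at h

theorem exists_perm_zero_one {i j : Fin 3} (h : i ≠ j) :
    ∃ e : Equiv.Perm (Fin 3), e 0 = i ∧ e 1 = j := by
  decide +revert

theorem cubeMean_coord (i : Fin 3) : cubeMean (coord i) = 0 := by
  have h := cubeMean_prod_coord_pow (Pi.single 0 1)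
  rw [← cubeMean_permute (Equiv.swap i 0), permute_coord, Equiv.swap_apply_left]
  simpa [Fin.prod_univ_three] using h

theorem cubeMean_coord_mul_coord (i j : Fin 3) :
    cubeMean (coord i * coord j) = if i = j then 1 / 2 else 0 := by
  split_ifs with hij
  · have h := cubeMean_prod_coord_pow (Pi.single 0 2)
    have hmass : (2 * π)⁻¹ * (π + π) = 1 := by field_simp; ring
    have hsq : (2 * π)⁻¹ * π = 1 / 2 := by field_simp
    rw [← hij, ← sq, ← cubeMean_permute (Equiv.swap i 0), map_pow, permute_coord,
      Equiv.swap_apply_left]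
    simpa [Fin.prod_univ_three, hmass, hsq, -mul_inv_rev] using h
  · have h := cubeMean_prod_coord_pow (Pi.single 0 1 + Pi.single 1 1)
    obtain ⟨e, rfl, rfl⟩ := exists_perm_zero_one hij
    rw [← permute_coord, ← permute_coord, ← map_mul, cubeMean_permute]
    simpa [Fin.prod_univ_three] using h

end CosineCube

section EdgeResolvent

open Real

/-- The dispersion function at zero quasimomentum, as a function of the cosines of the momenta. -/
def edge : C(CosCube, ℝ) := (4 : ℝ) • ∑ i, (1 - coord i)

theorem edge_apply (x : CosCube) : edge x = 4 * ∑ i, (1 - (x i : ℝ)) := by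
  simp only [edge, ContinuousMap.smul_apply, ContinuousMap.sum_apply, ContinuousMap.sub_apply,
    ContinuousMap.one_apply, coord_apply, smul_eq_mul]

theorem edge_nonneg (x : CosCube) : 0 ≤ edge x := by
  rw [edge_apply]
  exact mul_nonneg (by norm_num) (Finset.sum_nonneg fun i _ => sub_nonneg.2 (x i).2.2)

theorem edge_le (x : CosCube) : edge x ≤ 24 := by
  rw [edge_apply, Fin.sum_univ_three]
  linarith [(x 0).2.1, (x 1).2.1, (x 2).2.1]

theorem permute_edge (e : Equiv.Perm (Fin 3)) : permute e edge = edge := by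
  simp only [edge, map_smul, map_sum, map_sub, map_one, permute_coord]
  rw [Equiv.sum_comp e fun i => 1 - coord i]

theorem cubeMean_edge : cubeMean edge = 12 := by
  simp only [edge, map_smul, map_sum, map_sub, cubeMean_one, cubeMean_coord]
  norm_num

theorem cubeMean_edge_mul_coord (i : Fin 3) : cubeMean (edge * coord i) = -2 := by
  simp only [edge, smul_mul_assoc, Finset.sum_mul, sub_mul, one_mul, map_smul, map_sum, map_sub,
    cubeMean_coord, cubeMean_coord_mul_coord, Finset.sum_sub_distrib]
  norm_num

theorem cubeMean_edge_mul_edge : cubeMean (edge * edge) = 168 := by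
  nth_rw 2 [edge]
  simp only [mul_smul_comm, Finset.mul_sum, mul_sub, mul_one, map_smul, map_sum, map_sub,
    cubeMean_edge, cubeMean_edge_mul_coord]
  norm_num

/-- The mean over the torus of `g / (𝓔₀ + ε)`. It is of interest for `ε > 0`, where the integrand
is continuous, and for `ε = 0`, where it is integrable because the torus has dimension three. -/
def resolventMean (g : C(CosCube, ℝ)) (ε : ℝ) : ℝ :=
  ((2 * π) ^ 3)⁻¹ * ∫ x, g x / (edge x + ε) ∂cubeMeasure

/-- The resolvent function `(𝓔₀ + ε)⁻¹` below the edge of the spectrum. -/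
def edgeResolvent {ε : ℝ} (hε : 0 < ε) : C(CosCube, ℝ) :=
  ⟨fun x => (edge x + ε)⁻¹, by
    have h x : edge x + ε ≠ 0 := (add_pos_of_nonneg_of_pos (edge_nonneg x) hε).ne'
    fun_prop (disch := exact h _)⟩

theorem edgeResolvent_apply {ε : ℝ} (hε : 0 < ε) (x : CosCube) :
    edgeResolvent hε x = (edge x + ε)⁻¹ := rfl

theorem permute_edgeResolvent (e : Equiv.Perm (Fin 3)) {ε : ℝ} (hε : 0 < ε) :
    permute e (edgeResolvent hε) = edgeResolvent hε := by
  ext x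
  rw [permute_apply, edgeResolvent_apply, edgeResolvent_apply, ← permute_apply, permute_edge]

theorem edge_mul_edgeResolvent {ε : ℝ} (hε : 0 < ε) :
    edge * edgeResolvent hε = 1 - ε • edgeResolvent hε := by
  ext x
  have h : edge x + ε ≠ 0 := (add_pos_of_nonneg_of_pos (edge_nonneg x) hε).ne'
  simp only [ContinuousMap.mul_apply, ContinuousMap.sub_apply, ContinuousMap.one_apply,
    ContinuousMap.smul_apply, edgeResolvent_apply, smul_eq_mul]
  field_simp
  ring

theorem cubeMean_mul_edgeResolvent (g : C(CosCube, ℝ)) {ε : ℝ} (hε : 0 < ε) :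
    cubeMean (g * edgeResolvent hε) = resolventMean g ε := rfl

theorem resolventMean_zero_eq_integral (g : C(CosCube, ℝ)) :
    resolventMean g 0 = ((2 * π) ^ 3)⁻¹ * ∫ p, g (cosMap 0 p) / dispersion 0 p ∂torusMeasure := by
  have h : Measurable fun x => g x / edge x := by fun_prop
  simp only [resolventMean, add_zero, ← integral_comp_cosMap h 0]
  simp [edge_apply, dispersion, cosMap]

theorem a11_eq_resolventMean : a11 = resolventMean 1 0 := by
  rw [a11, resolventMean_zero_eq_integral, ← integral_const_mul]
  congr 1 with p
  rw [div_pow, sq_sqrt (by positivity), ContinuousMap.one_apply]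
  ring

theorem aA12_eq_resolventMean : aA12 = resolventMean ((coord 0 - coord 1) ^ 2) 0 := by
  rw [aA12, resolventMean_zero_eq_integral, ← integral_const_mul]
  congr 1 with p
  rw [div_pow, sq_sqrt (by positivity)]
  simp only [cosMap, ContinuousMap.pow_apply, ContinuousMap.sub_apply, coord_apply, Pi.zero_apply,
    add_zero]
  ring

theorem integrableOn_abs_rpow {r : ℝ} (hr : -1 < r) {a : ℝ} (ha : 0 ≤ a) :
    IntegrableOn (fun t : ℝ => |t| ^ r) (Set.Ico (-a) a) := by
  have h : IntervalIntegrable (fun t : ℝ => |t| ^ r) volume (-a) a := by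
    refine intervalIntegrable_of_even (fun t => by rw [abs_neg]) fun b hb => ?_
    refine (intervalIntegral.intervalIntegrable_rpow' hr).congr fun t ht => ?_
    rw [Set.uIoc_of_le hb.le] at ht
    rw [abs_of_pos ht.1]
  rwa [intervalIntegrable_iff_integrableOn_Ico_of_le (by linarith)] at h

theorem integrable_one_sub_rpow_arcsineMeasure :
    Integrable (fun x : Set.Icc (-1 : ℝ) 1 => (1 - (x : ℝ)) ^ (-(1 / 3) : ℝ)) arcsineMeasure := by
  have hcos := measurePreserving_cos_add 0
  have hmeas : Measurable fun x : Set.Icc (-1 : ℝ) 1 => (1 - (x : ℝ)) ^ (-(1 / 3) : ℝ) :=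
    (measurable_const.sub measurable_subtype_coe).pow_const _
  rw [← hcos.integrable_comp hmeas.aestronglyMeasurable]
  refine ((integrableOn_abs_rpow (r := -(2 / 3)) (by norm_num) pi_pos.le).const_mul
    ((2 / π ^ 2) ^ (-(1 / 3) : ℝ))).mono' (hmeas.comp hcos.measurable).aestronglyMeasurable ?_
  filter_upwards [ae_restrict_mem measurableSet_Ico] with t ht
  simp only [Function.comp_apply, add_zero]
  rw [norm_of_nonneg (rpow_nonneg (sub_nonneg.2 (cos_le_one t)) _)]
  rcases eq_or_ne t 0 with rfl | ht0
  · simp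
  have hpow : |t| ^ (-(2 / 3) : ℝ) = (t ^ 2) ^ (-(1 / 3) : ℝ) := by
    rw [← sq_abs, ← rpow_natCast, ← rpow_mul (abs_nonneg t)]
    norm_num
  rw [hpow, ← mul_rpow (by positivity) (by positivity)]
  refine rpow_le_rpow_of_nonpos (by positivity) ?_ (by norm_num)
  linarith [cos_le_one_sub_mul_cos_sq (abs_le.2 ⟨ht.1, ht.2.le⟩)]

theorem ae_lt_one_arcsineMeasure : ∀ᵐ x : Set.Icc (-1 : ℝ) 1 ∂arcsineMeasure, (x : ℝ) < 1 := by
  have hcos := measurePreserving_cos_add 0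
  have hset : MeasurableSet {x : Set.Icc (-1 : ℝ) 1 | (x : ℝ) < 1} :=
    measurableSet_lt measurable_subtype_coe measurable_const
  rw [← hcos.map_eq, ae_map_iff hcos.measurable.aemeasurable hset]
  filter_upwards [ae_restrict_mem measurableSet_Ico, ae_restrict_of_ae (Measure.ae_ne volume 0)]
    with t ht ht0
  have hpi := pi_pos
  refine lt_of_le_of_ne (cos_le_one _) fun h => ht0 ?_
  rwa [add_zero, cos_eq_one_iff_of_lt_of_lt (by linarith [ht.1]) (by linarith [ht.2])] at h

theorem ae_lt_one_cubeMeasure : ∀ᵐ x ∂cubeMeasure, ∀ i, (x i : ℝ) < 1 :=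
  ae_all_iff.2 fun i => (Measure.quasiMeasurePreserving_eval
    (μ := fun _ : Fin 3 => arcsineMeasure) i).ae ae_lt_one_arcsineMeasure

theorem ae_edge_pos : ∀ᵐ x ∂cubeMeasure, 0 < edge x := by
  filter_upwards [ae_lt_one_cubeMeasure] with x hx
  rw [edge_apply]
  exact mul_pos four_pos
    (Finset.sum_pos (fun i _ => sub_pos.2 (hx i)) Finset.univ_nonempty)

theorem prod_one_sub_rpow_le_edge (x : CosCube) :
    12 * ∏ i, (1 - (x i : ℝ)) ^ (1 / 3 : ℝ) ≤ edge x := by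
  have hx i : 0 ≤ 1 - (x i : ℝ) := sub_nonneg.2 (x i).2.2
  have h := geom_mean_le_arith_mean_weighted Finset.univ (fun _ : Fin 3 => (1 / 3 : ℝ))
    (fun i => 1 - (x i : ℝ)) (fun _ _ => by norm_num) (by norm_num) fun i _ => hx i
  rw [← Finset.mul_sum] at h
  rw [edge_apply]
  linarith

theorem integrable_inv_edge : Integrable (fun x => (edge x)⁻¹) cubeMeasure := by
  have hprod : Integrable (fun x : CosCube => ∏ i, (1 - (x i : ℝ)) ^ (-(1 / 3) : ℝ)) cubeMeasure :=
    Integrable.fintype_prod fun _ => integrable_one_sub_rpow_arcsineMeasure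
  refine (hprod.const_mul 12⁻¹).mono' (by fun_prop) ?_
  filter_upwards [ae_lt_one_cubeMeasure] with x hx
  have hpos : 0 < ∏ i, (1 - (x i : ℝ)) ^ (1 / 3 : ℝ) :=
    Finset.prod_pos fun i _ => rpow_pos_of_pos (sub_pos.2 (hx i)) _
  rw [norm_of_nonneg (inv_nonneg.2 (edge_nonneg x))]
  calc (edge x)⁻¹ ≤ (12 * ∏ i, (1 - (x i : ℝ)) ^ (1 / 3 : ℝ))⁻¹ :=
        inv_anti₀ (by positivity) (prod_one_sub_rpow_le_edge x)
    _ = 12⁻¹ * ∏ i, (1 - (x i : ℝ)) ^ (-(1 / 3) : ℝ) := by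
        rw [mul_inv, ← Finset.prod_inv_distrib]
        simp only [rpow_neg (sub_nonneg.2 (hx _).le)]

theorem integrable_div_edge (g : C(CosCube, ℝ)) :
    Integrable (fun x => g x / edge x) cubeMeasure :=
  integrable_inv_edge.bdd_mul g.continuous.aestronglyMeasurable
    (Eventually.of_forall g.norm_coe_le_norm)

theorem tendsto_resolventMean (g : C(CosCube, ℝ)) :
    Tendsto (resolventMean g) (𝓝[>] 0) (𝓝 (resolventMean g 0)) := by
  refine Tendsto.const_mul _ (tendsto_integral_filter_of_dominated_convergence
    (fun x => |g x / edge x|) (Eventually.of_forall fun ε => Measurable.aestronglyMeasurable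
      (by fun_prop)) ?_
    (integrable_div_edge g).abs ?_)
  · filter_upwards [self_mem_nhdsWithin] with ε (hε : 0 < ε)
    filter_upwards [ae_edge_pos] with x hx
    rw [norm_eq_abs, abs_div, abs_div, abs_of_pos hx, abs_of_pos (add_pos hx hε)]
    exact div_le_div_of_nonneg_left (abs_nonneg _) hx (le_add_of_nonneg_right hε.le)
  · filter_upwards [ae_edge_pos] with x hx
    have hx0 : edge x + 0 ≠ 0 := by simpa using hx.ne'
    have hcont : ContinuousAt (fun ε => g x / (edge x + ε)) 0 := by fun_prop (disch := exact hx0)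
    exact hcont.tendsto.mono_left nhdsWithin_le_nhds

theorem cubeMean_le_resolventMean_zero {F g : C(CosCube, ℝ)} (h : F * edge ≤ g) :
    cubeMean F ≤ resolventMean g 0 := by
  have hint := integrable_div_edge g
  simp only [resolventMean, add_zero]
  refine mul_le_mul_of_nonneg_left (integral_mono_ae (integrable_cubeMeasure F) hint ?_)
    (by positivity)
  filter_upwards [ae_edge_pos] with x hx
  exact (le_div_iff₀ hx).2 (h x)

theorem aA12_pos : 0 < aA12 := by
  have hmean : cubeMean ((24⁻¹ : ℝ) • (coord 0 - coord 1) ^ 2) = 24⁻¹ := by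
    simp only [sq, sub_mul, mul_sub, map_smul, map_sub, cubeMean_coord_mul_coord, smul_eq_mul]
    norm_num
  have hle := cubeMean_le_resolventMean_zero (F := (24⁻¹ : ℝ) • (coord 0 - coord 1) ^ 2)
    (g := (coord 0 - coord 1) ^ 2) (ContinuousMap.le_def.2 fun x => by
      have := mul_le_mul_of_nonneg_left (edge_le x) (sq_nonneg ((x 0 : ℝ) - x 1))
      simp only [ContinuousMap.mul_apply, ContinuousMap.smul_apply, ContinuousMap.pow_apply,
        ContinuousMap.sub_apply, coord_apply, smul_eq_mul]
      linarith)
  rw [aA12_eq_resolventMean]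
  linarith

theorem one_lt_twelve_mul_a11 : 1 < 12 * a11 := by
  -- For `s = ∑ᵢ cos pᵢ = (12 - 𝓔₀) / 4`, this is `s² / 24 ≤ s² / 𝓔₀` solved for `1 / 𝓔₀`.
  have hle := cubeMean_le_resolventMean_zero (g := 1)
    (F := (5 / 24 : ℝ) • 1 - (1 / 72 : ℝ) • edge + (1 / 3456 : ℝ) • (edge * edge))
    (ContinuousMap.le_def.2 fun x => by
      have h := mul_nonneg (sub_nonneg.2 (edge_le x)) (sq_nonneg (edge x - 12))
      simp only [ContinuousMap.mul_apply, ContinuousMap.smul_apply, ContinuousMap.add_apply,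
        ContinuousMap.sub_apply, ContinuousMap.one_apply, smul_eq_mul]
      linarith)
  simp only [map_add, map_sub, map_smul, cubeMean_one, cubeMean_edge, cubeMean_edge_mul_edge,
    smul_eq_mul] at hle
  rw [a11_eq_resolventMean]
  linarith

end EdgeResolvent

section CubeForm

/-- The quadratic form of `𝓔₀ + V` with couplings `ν₁, ν₂`, divided by `(2π)³`, on trial functions
of the cosines of the momenta. -/
def cubeForm (ν₁ ν₂ : ℝ) : LinearMap.BilinForm ℝ C(CosCube, ℝ) :=
  LinearMap.mk₂ ℝ
    (fun F G => cubeMean (edge * (F * G)) + ν₁ * (cubeMean F * cubeMean G) +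
      2 * ν₂ * ∑ i, cubeMean (coord i * F) * cubeMean (coord i * G))
    (fun F₁ F₂ G => by simp only [add_mul, mul_add, map_add, Finset.sum_add_distrib]; ring)
    (fun c F G => by
      simp only [smul_mul_assoc, mul_smul_comm, map_smul, smul_eq_mul, mul_assoc, ← Finset.mul_sum]
      ring)
    (fun F G₁ G₂ => by simp only [mul_add, map_add, Finset.sum_add_distrib]; ring)
    (fun c F G => by
      simp only [mul_smul_comm, map_smul, smul_eq_mul, mul_left_comm _ c, ← Finset.mul_sum]
      ring)

variable {ν₁ ν₂ : ℝ} {F G w : C(CosCube, ℝ)} {u v : Fin 3 → ℝ} {ε : ℝ}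

theorem cubeForm_apply (F G : C(CosCube, ℝ)) :
    cubeForm ν₁ ν₂ F G = cubeMean (edge * (F * G)) + ν₁ * (cubeMean F * cubeMean G) +
      2 * ν₂ * ∑ i, cubeMean (coord i * F) * cubeMean (coord i * G) := rfl

theorem isSymm_cubeForm (ν₁ ν₂ : ℝ) : (cubeForm ν₁ ν₂).IsSymm := ⟨fun F G => by
  simp only [cubeForm_apply, mul_comm F, mul_comm (cubeMean F),
    mul_comm (cubeMean (coord _ * F))]⟩

/-- Permutation invariance in the three momenta. -/
def IsPermInvariant (F : C(CosCube, ℝ)) : Prop := ∀ e, permute e F = F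

theorem IsPermInvariant.mul (hF : IsPermInvariant F) (hG : IsPermInvariant G) :
    IsPermInvariant (F * G) := fun e => by rw [map_mul, hF e, hG e]

theorem IsPermInvariant.cubeMean_mul_eq (hw : IsPermInvariant w) (e : Equiv.Perm (Fin 3))
    (F : C(CosCube, ℝ)) : cubeMean (permute e F * w) = cubeMean (F * w) := by
  rw [← cubeMean_permute e (F * w), map_mul (permute e), hw e]

theorem isPermInvariant_edge : IsPermInvariant edge := permute_edge

theorem isPermInvariant_edgeResolvent (hε : 0 < ε) : IsPermInvariant (edgeResolvent hε) :=
  fun e => permute_edgeResolvent e hε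

/-- The trigonometric polynomial `∑ᵢ uᵢ cos pᵢ`. -/
def coordSum (u : Fin 3 → ℝ) : C(CosCube, ℝ) := ∑ i, u i • coord i

/-- For permutation-invariant `w`, the difference of the means of `cos² p₁ · w` and of
`cos p₁ cos p₂ · w`. -/
def coordSpread (w : C(CosCube, ℝ)) : ℝ := cubeMean ((coord 0 - coord 1) ^ 2 * w) / 2

theorem coordSpread_mono (h : F ≤ G) : coordSpread F ≤ coordSpread G :=
  div_le_div_of_nonneg_right (cubeMean_mono fun x => mul_le_mul_of_nonneg_left (h x)
    (sq_nonneg ((coord 0 - coord 1) x))) zero_le_two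

theorem IsPermInvariant.cubeMean_coord_mul (hw : IsPermInvariant w) (i j : Fin 3) :
    cubeMean (coord i * w) = cubeMean (coord j * w) := by
  have h := hw.cubeMean_mul_eq (Equiv.swap i j) (coord i)
  rw [permute_coord, Equiv.swap_apply_left] at h
  exact h.symm

theorem IsPermInvariant.cubeMean_coord_mul_coord_mul (hw : IsPermInvariant w) (i j : Fin 3) :
    cubeMean (coord i * (coord j * w)) =
      cubeMean (coord 0 * coord 1 * w) + if i = j then coordSpread w else 0 := by
  have hdiag k : cubeMean (coord k * coord k * w) = cubeMean (coord 0 * coord 0 * w) := by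
    have h := hw.cubeMean_mul_eq (Equiv.swap 0 k) (coord 0 * coord 0)
    rwa [map_mul (permute _), permute_coord, Equiv.swap_apply_left] at h
  rw [← mul_assoc]
  split_ifs with hij
  · have hexp : (coord 0 - coord 1) ^ 2 * w =
        coord 0 * coord 0 * w + coord 1 * coord 1 * w - (2 : ℝ) • (coord 0 * coord 1 * w) := by
      rw [two_smul]
      ring
    rw [← hij, hdiag i, coordSpread, hexp, map_sub, map_add, map_smul, hdiag 1, smul_eq_mul]
    ring
  · obtain ⟨e, rfl, rfl⟩ := exists_perm_zero_one hij
    rw [← permute_coord, ← permute_coord, ← map_mul (permute e), hw.cubeMean_mul_eq, add_zero]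

theorem IsPermInvariant.cubeMean_coordSum_mul (hw : IsPermInvariant w) (hu : ∑ i, u i = 0) :
    cubeMean (coordSum u * w) = 0 := by
  rw [coordSum, Finset.sum_mul, map_sum]
  simp only [smul_mul_assoc, map_smul, smul_eq_mul, hw.cubeMean_coord_mul _ 0]
  rw [← Finset.sum_mul, hu, zero_mul]

theorem IsPermInvariant.cubeMean_coord_mul_coordSum_mul (hw : IsPermInvariant w)
    (hu : ∑ i, u i = 0) (i : Fin 3) :
    cubeMean (coord i * (coordSum u * w)) = u i * coordSpread w := by
  rw [coordSum, Finset.sum_mul, Finset.mul_sum, map_sum]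
  simp only [smul_mul_assoc, mul_smul_comm, map_smul, smul_eq_mul,
    hw.cubeMean_coord_mul_coord_mul, mul_add, mul_ite, mul_zero, Finset.sum_add_distrib,
    Finset.sum_ite_eq, Finset.mem_univ, if_true]
  rw [← Finset.sum_mul, hu, zero_mul, zero_add]

theorem IsPermInvariant.cubeForm_coordSum_mul (hF : IsPermInvariant F) (hw : IsPermInvariant w)
    (hu : ∑ i, u i = 0) : cubeForm ν₁ ν₂ F (coordSum u * w) = 0 := by
  have hE : edge * (F * (coordSum u * w)) = coordSum u * (edge * F * w) := by ring
  rw [cubeForm_apply, hE,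
    ((isPermInvariant_edge.mul hF).mul hw).cubeMean_coordSum_mul hu, hw.cubeMean_coordSum_mul hu]
  simp only [hF.cubeMean_coord_mul _ 0, hw.cubeMean_coord_mul_coordSum_mul hu, ← Finset.mul_sum,
    ← Finset.sum_mul, hu]
  ring

theorem IsPermInvariant.cubeForm_coordSum_mul_coordSum_mul (hw : IsPermInvariant w)
    (hu : ∑ i, u i = 0) (hv : ∑ i, v i = 0) :
    cubeForm ν₁ ν₂ (coordSum u * w) (coordSum v * w) =
      (u ⬝ᵥ v) * (coordSpread (edge * (w * w)) + 2 * ν₂ * coordSpread w ^ 2) := by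
  have hE : edge * (coordSum u * w * (coordSum v * w)) =
      coordSum u * (coordSum v * (edge * (w * w))) := by ring
  have hww := isPermInvariant_edge.mul (hw.mul hw)
  have hmain : cubeMean (coordSum u * (coordSum v * (edge * (w * w)))) =
      (u ⬝ᵥ v) * coordSpread (edge * (w * w)) := by
    rw [coordSum, Finset.sum_mul, map_sum, dotProduct, Finset.sum_mul]
    simp only [smul_mul_assoc, map_smul, hww.cubeMean_coord_mul_coordSum_mul hv, smul_eq_mul,
      mul_assoc]
  have hint : ∑ i, u i * coordSpread w * (v i * coordSpread w) = (u ⬝ᵥ v) * coordSpread w ^ 2 := by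
    rw [dotProduct, Finset.sum_mul]
    exact Finset.sum_congr rfl fun i _ => by ring
  rw [cubeForm_apply, hE, hmain, hw.cubeMean_coordSum_mul hu]
  simp only [hw.cubeMean_coord_mul_coordSum_mul hu, hw.cubeMean_coord_mul_coordSum_mul hv, hint]
  ring

theorem cubeMean_edgeResolvent (hε : 0 < ε) :
    cubeMean (edgeResolvent hε) = resolventMean 1 ε := by
  rw [← cubeMean_mul_edgeResolvent, one_mul]

theorem cubeMean_edge_mul_edgeResolvent (hε : 0 < ε) :
    cubeMean (edge * edgeResolvent hε) = 1 - ε * resolventMean 1 ε := by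
  rw [edge_mul_edgeResolvent, map_sub, map_smul, cubeMean_one, cubeMean_edgeResolvent, smul_eq_mul]

theorem cubeMean_coord_mul_edgeResolvent (hε : 0 < ε) (i : Fin 3) :
    cubeMean (coord i * edgeResolvent hε) =
      (12 * resolventMean 1 ε - 1 + ε * resolventMean 1 ε) / 12 := by
  have h := cubeMean_edge_mul_edgeResolvent hε
  simp only [edge, smul_mul_assoc, Finset.sum_mul, sub_mul, one_mul, map_smul, map_sum, map_sub,
    cubeMean_edgeResolvent, (isPermInvariant_edgeResolvent hε).cubeMean_coord_mul _ i] at h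
  simp only [Finset.sum_const, Finset.card_univ, Fintype.card_fin, nsmul_eq_mul, smul_eq_mul] at h
  push_cast at h
  linarith

theorem edge_mul_edgeResolvent_mul_edgeResolvent_le (hε : 0 < ε) :
    edge * (edgeResolvent hε * edgeResolvent hε) ≤ edgeResolvent hε := fun x => by
  have hx : 0 < edge x + ε := add_pos_of_nonneg_of_pos (edge_nonneg x) hε
  calc edge x * ((edge x + ε)⁻¹ * (edge x + ε)⁻¹)
      ≤ (edge x + ε) * ((edge x + ε)⁻¹ * (edge x + ε)⁻¹) := by
        gcongr
        exact le_add_of_nonneg_right hε.le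
    _ = (edge x + ε)⁻¹ := mul_inv_cancel_left₀ hx.ne' _

theorem cubeForm_one_one : cubeForm ν₁ ν₂ 1 1 = 12 + ν₁ := by
  simp only [cubeForm_apply, mul_one, cubeMean_edge, cubeMean_one, cubeMean_coord,
    Finset.sum_const_zero, mul_zero, add_zero]

theorem cubeForm_one_edgeResolvent (hε : 0 < ε) :
    cubeForm ν₁ ν₂ 1 (edgeResolvent hε) =
      1 - ε * resolventMean 1 ε + ν₁ * resolventMean 1 ε := by
  simp only [cubeForm_apply, one_mul, mul_one, cubeMean_one, cubeMean_coord, zero_mul,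
    Finset.sum_const_zero, mul_zero, add_zero, cubeMean_edge_mul_edgeResolvent,
    cubeMean_edgeResolvent]

theorem cubeForm_edgeResolvent_le (hε : 0 < ε) :
    cubeForm ν₁ ν₂ (edgeResolvent hε) (edgeResolvent hε) ≤
      resolventMean 1 ε + ν₁ * resolventMean 1 ε ^ 2 +
        ν₂ * (12 * resolventMean 1 ε - 1 + ε * resolventMean 1 ε) ^ 2 / 24 := by
  have h := cubeMean_mono (edge_mul_edgeResolvent_mul_edgeResolvent_le hε)
  simp only [cubeForm_apply, cubeMean_coord_mul_edgeResolvent, cubeMean_edgeResolvent,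
    Finset.sum_const, Finset.card_univ, Fintype.card_fin, nsmul_eq_mul] at h ⊢
  push_cast
  linarith

/-- An upper bound for `cubeForm ν₁ ν₂` at `x + (𝓔₀ + ε)⁻¹`, where `J` is the mean of
`(𝓔₀ + ε)⁻¹`. -/
def symmetricBound (ν₁ ν₂ x ε J : ℝ) : ℝ :=
  12 * x ^ 2 + 2 * x * (1 - ε * J) + J + ν₁ * (x + J) ^ 2 + ν₂ * (12 * J - 1 + ε * J) ^ 2 / 24

theorem cubeForm_add_edgeResolvent_le (hε : 0 < ε) (x : ℝ) :
    cubeForm ν₁ ν₂ (x • 1 + edgeResolvent hε) (x • 1 + edgeResolvent hε) ≤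
      symmetricBound ν₁ ν₂ x ε (resolventMean 1 ε) := by
  have h := cubeForm_edgeResolvent_le (ν₁ := ν₁) (ν₂ := ν₂) hε
  simp only [map_add, map_smul, LinearMap.add_apply, LinearMap.smul_apply, smul_eq_mul,
    (isSymm_cubeForm ν₁ ν₂).eq (edgeResolvent hε) 1, cubeForm_one_one, cubeForm_one_edgeResolvent]
  rw [symmetricBound]
  linarith

theorem isPermInvariant_add_edgeResolvent (hε : 0 < ε) (x : ℝ) :
    IsPermInvariant (x • 1 + edgeResolvent hε) := fun e => by
  rw [map_add, map_smul, map_one, permute_edgeResolvent]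

theorem cubeForm_coordSum_mul_edgeResolvent_le (hε : 0 < ε) (hu : ∑ i, u i = 0) :
    cubeForm ν₁ ν₂ (coordSum u * edgeResolvent hε) (coordSum u * edgeResolvent hε) ≤
      (u ⬝ᵥ u) / 2 * (resolventMean ((coord 0 - coord 1) ^ 2) ε *
        (1 + ν₂ * resolventMean ((coord 0 - coord 1) ^ 2) ε)) := by
  have hspread :
      coordSpread (edgeResolvent hε) = resolventMean ((coord 0 - coord 1) ^ 2) ε / 2 := by
    rw [coordSpread, cubeMean_mul_edgeResolvent]
  have hle := coordSpread_mono (edge_mul_edgeResolvent_mul_edgeResolvent_le hε)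
  have hw := isPermInvariant_edgeResolvent hε
  rw [hw.cubeForm_coordSum_mul_coordSum_mul hu hu, div_mul_eq_mul_div, mul_div_assoc]
  refine mul_le_mul_of_nonneg_left ?_ (Finset.sum_nonneg fun i _ => mul_self_nonneg (u i))
  rw [hspread] at hle ⊢
  linarith

end CubeForm

section TrialFamilies

/-- A family of vectors, pairwise orthogonal for the form `Q`, on each of which `Q` is negative:
it exhibits `ι` as a lower bound for the negative index of `Q`. -/
def IsNegativeFamily {ι V : Type*} [AddCommGroup V] [Module ℝ V] (Q : LinearMap.BilinForm ℝ V)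
    (F : ι → V) : Prop :=
  (∀ i j, i ≠ j → Q (F i) (F j) = 0) ∧ ∀ i, Q (F i) (F i) < 0

section IsNegativeFamily

variable {V : Type*} [AddCommGroup V] [Module ℝ V] {Q : LinearMap.BilinForm ℝ V}

theorem isNegativeFamily_of_subsingleton {ι : Type*} [Subsingleton ι] {F : ι → V}
    (h : ∀ i, Q (F i) (F i) < 0) : IsNegativeFamily Q F :=
  ⟨fun i j hij => absurd (Subsingleton.elim i j) hij, h⟩

theorem isNegativeFamily_pair (hQ : Q.IsSymm) {x y : V} (hx : Q x x < 0) (hy : Q y y < 0)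
    (hxy : Q x y = 0) : IsNegativeFamily Q ![x, y] :=
  ⟨by simp [Fin.forall_fin_two, hxy, hQ.eq y x], by simp [Fin.forall_fin_two, hx, hy]⟩

theorem IsNegativeFamily.append (hQ : Q.IsSymm) {m n : ℕ} {F : Fin m → V} {G : Fin n → V}
    (hF : IsNegativeFamily Q F) (hG : IsNegativeFamily Q G) (h : ∀ i j, Q (F i) (G j) = 0) :
    IsNegativeFamily Q (Fin.append F G) := by
  constructor
  · intro i j hij
    induction i using Fin.addCases <;> induction j using Fin.addCases <;>
      simp only [Fin.append_left, Fin.append_right]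
    · exact hF.1 _ _ fun e => hij (congrArg _ e)
    · exact h _ _
    · exact (hQ.eq _ _).trans (h _ _)
    · exact hG.1 _ _ fun e => hij (congrArg _ e)
  · intro i
    induction i using Fin.addCases <;> simp only [Fin.append_left, Fin.append_right]
    · exact hF.2 _
    · exact hG.2 _

end IsNegativeFamily

variable {ν₁ ν₂ : ℝ} {n : ℕ}

theorem symmetricBound_sub_a11 (ν₁ ν₂ u : ℝ) : symmetricBound ν₁ ν₂ (u - a11) 0 a11 =
    (12 + ν₁) * u ^ 2 - 2 * (12 * a11 - 1) * u + (12 * a11 - 1) ^ 2 / 24 * (ν₂ + mu0) := by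
  have h : 12 * a11 - 1 ≠ 0 := (sub_pos.2 one_lt_twelve_mul_a11).ne'
  rw [symmetricBound, mu0]
  field_simp
  ring

/-- The critical point of the quadratic polynomial in `symmetricBound_sub_a11`, for `ν₁ ≠ -12`. -/
def criticalShift (ν₁ : ℝ) : ℝ := (12 * a11 - 1) / (ν₁ + 12) - a11

theorem symmetricBound_criticalShift (hν : ν₁ ≠ -12) (ν₂ : ℝ) :
    symmetricBound ν₁ ν₂ (criticalShift ν₁) 0 a11 =
      (12 * a11 - 1) ^ 2 / 24 * (ν₂ - mu2Minus ν₁) := by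
  have h : ν₁ + 12 ≠ 0 := fun h => hν (by linarith)
  rw [criticalShift, symmetricBound_sub_a11, mu2Minus]
  field_simp
  ring

theorem symmetricBound_criticalShift_neg (hν : ν₁ ≠ -12) (h : ν₂ < mu2Minus ν₁) :
    symmetricBound ν₁ ν₂ (criticalShift ν₁) 0 a11 < 0 := by
  have ha := sub_pos.2 one_lt_twelve_mul_a11
  rw [symmetricBound_criticalShift hν]
  exact mul_neg_of_pos_of_neg (by positivity) (sub_neg.2 h)

theorem exists_symmetricBound_neg_of_le (hν : ν₁ ≤ -12) (ν₂ : ℝ) :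
    ∃ x, symmetricBound ν₁ ν₂ x 0 a11 < 0 := by
  have ha := sub_pos.2 one_lt_twelve_mul_a11
  set κ := (12 * a11 - 1) ^ 2 / 24 * (ν₂ + mu0) with hκ
  set u := (|κ| + 1) / (2 * (12 * a11 - 1)) with hu
  refine ⟨u - a11, ?_⟩
  have hlin : 2 * (12 * a11 - 1) * u = |κ| + 1 := by
    rw [hu]
    field_simp
  have hquad : (12 + ν₁) * u ^ 2 ≤ 0 :=
    mul_nonpos_of_nonpos_of_nonneg (by linarith) (sq_nonneg u)
  rw [symmetricBound_sub_a11, ← hκ]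
  linarith [le_abs_self κ]

theorem exists_symmetricBound_neg_of_mem_AMinus_one (h : (ν₁, ν₂) ∈ AMinus 1) :
    ∃ x, symmetricBound ν₁ ν₂ x 0 a11 < 0 := by
  rcases le_or_gt ν₁ (-12) with hν | hν
  · exact exists_symmetricBound_neg_of_le hν ν₂
  · rcases h with (⟨-, h⟩ | h) | ⟨h, -⟩
    · exact ⟨_, symmetricBound_criticalShift_neg hν.ne' h⟩
    · exact absurd h hν.ne'
    · exact absurd h hν.not_gt

theorem tendsto_resolventMean_one : Tendsto (resolventMean 1) (𝓝[>] 0) (𝓝 a11) :=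
  a11_eq_resolventMean ▸ tendsto_resolventMean 1

theorem continuous_symmetricBound (ν₁ ν₂ : ℝ) :
    Continuous fun q : ℝ × ℝ × ℝ => symmetricBound ν₁ ν₂ q.1 q.2.1 q.2.2 := by
  unfold symmetricBound
  fun_prop

theorem tendsto_symmetricBound (ν₁ ν₂ : ℝ) {x : ℝ} {f : ℝ → ℝ} (hf : Tendsto f (𝓝[>] 0) (𝓝 x)) :
    Tendsto (fun ε => symmetricBound ν₁ ν₂ (f ε) ε (resolventMean 1 ε)) (𝓝[>] 0)
      (𝓝 (symmetricBound ν₁ ν₂ x 0 a11)) := by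
  have hε : Tendsto (fun ε : ℝ => ε) (𝓝[>] 0) (𝓝 0) := tendsto_id.mono_left nhdsWithin_le_nhds
  have harg := hf.prodMk_nhds (hε.prodMk_nhds tendsto_resolventMean_one)
  simpa only [Function.comp_def] using
    ((continuous_symmetricBound ν₁ ν₂).tendsto (x, 0, a11)).comp harg

theorem exists_cubeForm_add_edgeResolvent_neg {x : ℝ} {f : ℝ → ℝ}
    (hf : Tendsto f (𝓝[>] 0) (𝓝 x)) (hx : symmetricBound ν₁ ν₂ x 0 a11 < 0) :
    ∃ (ε : ℝ) (hε : 0 < ε),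
      cubeForm ν₁ ν₂ (f ε • 1 + edgeResolvent hε) (f ε • 1 + edgeResolvent hε) < 0 := by
  obtain ⟨ε, hneg, hε⟩ := ((tendsto_symmetricBound ν₁ ν₂ hf).eventually_lt_const hx |>.and
    self_mem_nhdsWithin).exists
  exact ⟨ε, hε, (cubeForm_add_edgeResolvent_le hε _).trans_lt hneg⟩

/-- The shift `x` for which `x + (𝓔₀ + ε)⁻¹` is orthogonal to the constants. -/
def orthogonalShift (ν₁ ε : ℝ) : ℝ :=
  -(1 - ε * resolventMean 1 ε + ν₁ * resolventMean 1 ε) / (ν₁ + 12)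

theorem cubeForm_one_orthogonalShift (hν : ν₁ ≠ -12) {ε : ℝ} (hε : 0 < ε) :
    cubeForm ν₁ ν₂ 1 (orthogonalShift ν₁ ε • 1 + edgeResolvent hε) = 0 := by
  have h : ν₁ + 12 ≠ 0 := fun h => hν (by linarith)
  rw [map_add, map_smul, cubeForm_one_one, cubeForm_one_edgeResolvent, orthogonalShift, smul_eq_mul]
  field_simp
  ring

theorem tendsto_orthogonalShift (hν : ν₁ ≠ -12) :
    Tendsto (orthogonalShift ν₁) (𝓝[>] 0) (𝓝 (criticalShift ν₁)) := by
  have h : ν₁ + 12 ≠ 0 := fun h => hν (by linarith)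
  have hlim : criticalShift ν₁ = -(1 - 0 * a11 + ν₁ * a11) / (ν₁ + 12) := by
    rw [criticalShift]
    field_simp
    ring
  have hε : Tendsto (fun ε : ℝ => ε) (𝓝[>] 0) (𝓝 0) := tendsto_id.mono_left nhdsWithin_le_nhds
  have hJ := tendsto_resolventMean_one
  rw [hlim]
  exact (((hε.mul hJ).const_sub 1).add (hJ.const_mul ν₁)).neg.div_const (ν₁ + 12)

theorem exists_isPermInvariant_isNegativeFamily (h : (ν₁, ν₂) ∈ AMinus n) :
    ∃ F : Fin n → C(CosCube, ℝ),
      (∀ i, IsPermInvariant (F i)) ∧ IsNegativeFamily (cubeForm ν₁ ν₂) F := by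
  match n, h with
  | 0, _ => exact ⟨Fin.elim0, fun i => i.elim0, fun i => i.elim0, fun i => i.elim0⟩
  | 1, h =>
    obtain ⟨x, hx⟩ := exists_symmetricBound_neg_of_mem_AMinus_one h
    obtain ⟨ε, hε, hneg⟩ := exists_cubeForm_add_edgeResolvent_neg tendsto_const_nhds hx
    exact ⟨fun _ => x • 1 + edgeResolvent hε, fun _ => isPermInvariant_add_edgeResolvent hε x,
      isNegativeFamily_of_subsingleton fun _ => hneg⟩
  | 2, ⟨hν, h⟩ =>
    have hν₁ : ν₁ ≠ -12 := ne_of_lt hν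
    obtain ⟨ε, hε, hneg⟩ := exists_cubeForm_add_edgeResolvent_neg (tendsto_orthogonalShift hν₁)
      (symmetricBound_criticalShift_neg hν₁ h)
    have hone : cubeForm ν₁ ν₂ 1 1 < 0 := by
      rw [cubeForm_one_one]
      linarith [show ν₁ < -12 from hν]
    refine ⟨![1, orthogonalShift ν₁ ε • 1 + edgeResolvent hε], Fin.forall_fin_two.2 ⟨?_, ?_⟩,
      isNegativeFamily_pair (isSymm_cubeForm ν₁ ν₂) hone hneg (cubeForm_one_orthogonalShift hν₁ hε)⟩
    · exact fun e => map_one (permute e)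
    · exact isPermInvariant_add_edgeResolvent hε _

theorem one_add_mul_aA12_neg (h : ν₂ ∈ BMinus1) : 1 + ν₂ * aA12 < 0 := by
  have h : ν₂ < -(1 / aA12) := h
  rw [← neg_div, lt_div_iff₀ aA12_pos] at h
  linarith

theorem exists_cubeForm_coordSum_mul_neg (ν₁ : ℝ) (h : ν₂ ∈ BMinus1) :
    ∃ w, IsPermInvariant w ∧ ∀ u : Fin 3 → ℝ, u ≠ 0 → ∑ i, u i = 0 →
      cubeForm ν₁ ν₂ (coordSum u * w) (coordSum u * w) < 0 := by
  have hA := tendsto_resolventMean ((coord 0 - coord 1) ^ 2)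
  rw [← aA12_eq_resolventMean] at hA
  have hlim := hA.mul ((hA.const_mul ν₂).const_add 1)
  obtain ⟨ε, hneg, hε⟩ := (hlim.eventually_lt_const
    (mul_neg_of_pos_of_neg aA12_pos (one_add_mul_aA12_neg h)) |>.and self_mem_nhdsWithin).exists
  refine ⟨edgeResolvent hε, isPermInvariant_edgeResolvent hε, fun u hu hsum => ?_⟩
  refine (cubeForm_coordSum_mul_edgeResolvent_le hε hsum).trans_lt
    (mul_neg_of_pos_of_neg (half_pos ?_) hneg)
  simpa using Matrix.dotProduct_self_star_pos_iff.2 hu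

theorem exists_isNegativeFamily_of_mem_BMinus1 (h : (ν₁, ν₂) ∈ AMinus n) (h₂ : ν₂ ∈ BMinus1) :
    ∃ F : Fin (n + 2) → C(CosCube, ℝ), IsNegativeFamily (cubeForm ν₁ ν₂) F := by
  obtain ⟨F, hsymm, hF⟩ := exists_isPermInvariant_isNegativeFamily h
  obtain ⟨w, hw, hneg⟩ := exists_cubeForm_coordSum_mul_neg ν₁ h₂
  set u : Fin 2 → Fin 3 → ℝ := ![![1, -1, 0], ![1, 1, -2]]
  have hsum : ∀ j, ∑ i, u j i = 0 := by
    simp [u, Fin.sum_univ_three, Fin.forall_fin_two, one_add_one_eq_two]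
  have hu : ∀ j, u j ≠ 0 := by simp [u, funext_iff, Fin.forall_fin_succ]
  have horth : u 0 ⬝ᵥ u 1 = 0 := by simp [u, dotProduct, Fin.sum_univ_three]
  have hcross : cubeForm ν₁ ν₂ (coordSum (u 0) * w) (coordSum (u 1) * w) = 0 := by
    rw [hw.cubeForm_coordSum_mul_coordSum_mul (hsum 0) (hsum 1), horth, zero_mul]
  have hQ := isSymm_cubeForm ν₁ ν₂
  have hpair := isNegativeFamily_pair hQ (hneg (u 0) (hu 0) (hsum 0))
    (hneg (u 1) (hu 1) (hsum 1)) hcross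
  refine ⟨_, hF.append hQ hpair fun i => Fin.forall_fin_two.2 ⟨?_, ?_⟩⟩
  · exact (hsymm i).cubeForm_coordSum_mul hw (hsum 0)
  · exact (hsymm i).cubeForm_coordSum_mul hw (hsum 1)

end TrialFamilies

section Operators

theorem isClosed_evenL2 : IsClosed (evenL2 : Set L2) := by
  let U := Lp.compMeasurePreservingₗᵢ ℂ (E := ℂ) (p := 2) (fun p : Fin 3 → ℝ => -p)
    measurePreserving_neg
  have h : (evenL2 : Set L2) = {f | U f = f} := by
    ext f
    have hU : U f =ᵐ[torusMeasure] fun p => f (-p) :=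
      Lp.coeFn_compMeasurePreserving f measurePreserving_neg
    rw [SetLike.mem_coe, mem_evenL2, Set.mem_ofPred_eq, Lp.ext_iff]
    exact ⟨hU.trans, hU.symm.trans⟩
  rw [h]
  exact isClosed_eq U.continuous continuous_id

instance : CompleteSpace evenL2 := isClosed_evenL2.completeSpace_coe

variable {φ : (Fin 3 → ℝ) → ℝ} {C : ℝ}

theorem isSelfAdjoint_mulOp (hφ : Continuous φ) (hC : ∀ p, |φ p| ≤ C) :
    IsSelfAdjoint (mulOp φ hφ C hC) := by
  refine ContinuousLinearMap.isSelfAdjoint_iff_isSymmetric.2 fun f g => ?_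
  rw [ContinuousLinearMap.coe_coe, L2.inner_def, L2.inner_def]
  refine integral_congr_ae ?_
  filter_upwards [mulOp_apply hφ hC f, mulOp_apply hφ hC g] with p hf hg
  rw [hf, hg, ← smul_eq_mul, ← smul_eq_mul, inner_smul_left, inner_smul_right, Complex.conj_ofReal]

theorem rankOne_eq (hφ : Continuous φ) (hC : ∀ p, |φ p| ≤ C) : rankOne φ hφ C hC =
    InnerProductSpace.rankOne ℂ ((memLp_ofReal hφ hC 2).toLp _) ((memLp_ofReal hφ hC 2).toLp _) :=
  rfl

theorem isSelfAdjoint_rankOne (hφ : Continuous φ) (hC : ∀ p, |φ p| ≤ C) :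
    IsSelfAdjoint (rankOne φ hφ C hC) := by
  rw [rankOne_eq]
  exact (InnerProductSpace.isPositive_rankOne_self _).isSelfAdjoint

theorem hasFiniteRange_rankOne (hφ : Continuous φ) (hC : ∀ p, |φ p| ≤ C) :
    (rankOne φ hφ C hC).toLinearMap.HasFiniteRange := by
  rw [rankOne_eq, InnerProductSpace.rankOne_def', ContinuousLinearMap.toLinearMap_comp]
  exact LinearMap.HasFiniteRange.of_finite_dom.comp_right _

theorem isSelfAdjoint_interaction (μ₁ μ₂ : ℝ) : IsSelfAdjoint (interaction μ₁ μ₂) := by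
  have hreal (c : ℝ) : IsSelfAdjoint (c : ℂ) := isSelfAdjoint_iff.2 (Complex.conj_ofReal c)
  exact ((hreal _).smul (isSelfAdjoint_rankOne _ _)).add
    ((hreal _).smul (isSelfAdjoint_sum _ fun i _ => isSelfAdjoint_rankOne _ _))

theorem hasFiniteRange_interaction (μ₁ μ₂ : ℝ) :
    (interaction μ₁ μ₂).toLinearMap.HasFiniteRange := by
  rw [interaction, Fin.sum_univ_three]
  exact ((hasFiniteRange_rankOne _ _).smul _).add
    ((((hasFiniteRange_rankOne _ _).add (hasFiniteRange_rankOne _ _)).add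
      (hasFiniteRange_rankOne _ _)).smul _)

theorem hasFiniteRange_of_coe_apply_eq {X : Type*} [AddCommGroup X] [Module ℂ X]
    {S : Submodule ℂ X} {A : X →ₗ[ℂ] X} {B : S →ₗ[ℂ] S} (hA : A.HasFiniteRange)
    (h : ∀ x, (B x : X) = A x) : B.HasFiniteRange := by
  have hB : S.subtype ∘ₗ B = A ∘ₗ S.subtype := LinearMap.ext h
  have hrange := hB ▸ hA.comp_right S.subtype
  rw [LinearMap.hasFiniteRange_iff_range, LinearMap.range_comp] at hrange
  rw [LinearMap.hasFiniteRange_iff_range]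
  exact Submodule.fg_of_fg_map_injective _ S.injective_subtype hrange

theorem isSelfAdjoint_hamiltonian (μ₁ μ₂ : ℝ) (K : Fin 3 → ℝ) :
    IsSelfAdjoint (hamiltonian μ₁ μ₂ K) := by
  have h : IsSelfAdjoint (freeOp K + interaction μ₁ μ₂) :=
    (isSelfAdjoint_mulOp _ _).add (isSelfAdjoint_interaction μ₁ μ₂)
  exact ContinuousLinearMap.isSelfAdjoint_iff_isSymmetric.2 fun f g =>
    (ContinuousLinearMap.isSelfAdjoint_iff_isSymmetric.1 h) f g

theorem freeOp_mem (K : Fin 3 → ℝ) : ∀ f ∈ evenL2, freeOp K f ∈ evenL2 := by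
  simpa [interaction] using fullHamiltonian_mem 0 0 K

/-- The free operator `H₀(K)` on `L^{2,e}(𝕋³)`. -/
def freeHamiltonian (K : Fin 3 → ℝ) : evenL2 →L[ℂ] evenL2 :=
  (freeOp K).restrict (freeOp_mem K)

theorem hasFiniteRange_hamiltonian_sub_freeHamiltonian (μ₁ μ₂ : ℝ) (K : Fin 3 → ℝ) :
    (hamiltonian μ₁ μ₂ K - freeHamiltonian K).toLinearMap.HasFiniteRange :=
  hasFiniteRange_of_coe_apply_eq (hasFiniteRange_interaction μ₁ μ₂) fun f =>
    add_sub_cancel_left (freeOp K f) (interaction μ₁ μ₂ f)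

theorem integrable_mul_norm_sq (hφ : Continuous φ) (hC : ∀ p, |φ p| ≤ C) (f : L2) :
    Integrable (fun p => φ p * ‖f p‖ ^ 2) torusMeasure :=
  ((Lp.memLp f).integrable_norm_pow two_ne_zero).bdd_mul hφ.aestronglyMeasurable (ae_of_all _ hC)

theorem reApplyInnerSelf_mulOp (hφ : Continuous φ) (hC : ∀ p, |φ p| ≤ C) (f : L2) :
    (mulOp φ hφ C hC).reApplyInnerSelf f = ∫ p, φ p * ‖f p‖ ^ 2 ∂torusMeasure := by
  have hinner : inner ℂ (mulOp φ hφ C hC f) f =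
      ((∫ p, φ p * ‖f p‖ ^ 2 ∂torusMeasure : ℝ) : ℂ) := by
    rw [L2.inner_def, ← integral_complex_ofReal]
    refine integral_congr_ae ?_
    filter_upwards [mulOp_apply hφ hC f] with p hp
    rw [hp, ← smul_eq_mul, inner_smul_left, Complex.conj_ofReal, inner_self_eq_norm_sq_to_K,
      Complex.ofReal_mul, Complex.ofReal_pow]
    rfl
  rw [ContinuousLinearMap.reApplyInnerSelf, hinner, RCLike.re_eq_complex_re,
    Complex.ofReal_re]

theorem mul_norm_sq_eq_integral (s : ℝ) (f : L2) :
    s * ‖f‖ ^ 2 = ∫ p, s * ‖f p‖ ^ 2 ∂torusMeasure := by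
  have h : ((‖f‖ ^ 2 : ℝ) : ℂ) = ((∫ p, ‖f p‖ ^ 2 ∂torusMeasure : ℝ) : ℂ) := by
    rw [← integral_complex_ofReal, Complex.ofReal_pow, ← RCLike.ofReal_eq_complex_ofReal,
      ← inner_self_eq_norm_sq_to_K, L2.inner_def]
    refine integral_congr_ae (ae_of_all _ fun p => ?_)
    simp only [inner_self_eq_norm_sq_to_K, Complex.ofReal_pow, RCLike.ofReal_eq_complex_ofReal]
  rw [integral_const_mul, Complex.ofReal_injective h]

end Operators

section CubeLift

open Real

/-- The shift `θᵢ ∈ {0, π}` for which `cos (Kᵢ / 2) cos pᵢ = |cos (Kᵢ / 2)| cos (pᵢ + θᵢ)`. -/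
def phase (K : Fin 3 → ℝ) (i : Fin 3) : ℝ := if 0 ≤ cos (K i / 2) then 0 else π

variable (K : Fin 3 → ℝ)

theorem sin_phase (i : Fin 3) : sin (phase K i) = 0 := by
  rw [phase]
  split_ifs <;> simp

theorem cos_phase_sq (i : Fin 3) : cos (phase K i) ^ 2 = 1 := by
  rw [cos_sq', sin_phase, zero_pow two_ne_zero, sub_zero]

theorem cos_add_phase (t : ℝ) (i : Fin 3) :
    cos (t + phase K i) = cos (phase K i) * cos t := by
  rw [cos_add, sin_phase, mul_zero, sub_zero, mul_comm]

theorem cos_eq_cos_phase_mul (p : Fin 3 → ℝ) (i : Fin 3) :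
    cos (p i) = cos (phase K i) * coord i (cosMap (phase K) p) := by
  change cos (p i) = cos (phase K i) * cos (p i + phase K i)
  rw [cos_add_phase, ← mul_assoc, ← sq, cos_phase_sq, one_mul]

theorem cosMap_phase_neg (p : Fin 3 → ℝ) : cosMap (phase K) (-p) = cosMap (phase K) p := by
  ext i
  simp only [cosMap, cos_add_phase, Pi.neg_apply, cos_neg]

theorem cos_half_mul_cos_phase (i : Fin 3) :
    cos (K i / 2) * cos (phase K i) = |cos (K i / 2)| := by
  rw [phase]
  split_ifs with h
  · rw [cos_zero, mul_one, abs_of_nonneg h]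
  · rw [cos_pi, mul_neg_one, abs_of_neg (not_le.1 h)]

/-- The minimum of the dispersion function `𝓔_K`. -/
def bandBottom : ℝ := 4 * ∑ i, (1 - |cos (K i / 2)|)

theorem dispersion_eq_bandBottom_add (p : Fin 3 → ℝ) : dispersion K p = bandBottom K +
    4 * ∑ i, |cos (K i / 2)| * (1 - (cosMap (phase K) p i : ℝ)) := by
  rw [dispersion, bandBottom, ← mul_add, ← Finset.sum_add_distrib]
  congr 2 with i
  rw [cos_eq_cos_phase_mul K p i, ← mul_assoc, cos_half_mul_cos_phase, coord_apply]
  ring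

theorem bandBottom_le_dispersion (p : Fin 3 → ℝ) : bandBottom K ≤ dispersion K p := by
  rw [dispersion_eq_bandBottom_add, le_add_iff_nonneg_right]
  exact mul_nonneg (by norm_num) <| Finset.sum_nonneg fun i _ =>
    mul_nonneg (abs_nonneg _) (sub_nonneg.2 (cosMap (phase K) p i).2.2)

theorem dispersion_le_bandBottom_add_edge (p : Fin 3 → ℝ) :
    dispersion K p ≤ bandBottom K + edge (cosMap (phase K) p) := by
  rw [dispersion_eq_bandBottom_add, edge_apply]
  gcongr with i
  exact mul_le_of_le_one_left (sub_nonneg.2 (cosMap (phase K) p i).2.2) (abs_cos_le_one _)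

theorem continuous_comp_cosMap (F : C(CosCube, ℝ)) :
    Continuous fun p => F (cosMap (phase K) p) :=
  F.continuous.comp (continuous_cosMap _)

theorem abs_comp_cosMap_le (F : C(CosCube, ℝ)) (p : Fin 3 → ℝ) :
    |F (cosMap (phase K) p)| ≤ ‖F‖ :=
  F.norm_coe_le_norm _

/-- The dispersion function of zero quasimomentum, aligned with that of `K` by the phase shift, as
a multiplication operator. -/
def edgeOp : L2 →L[ℂ] L2 :=
  mulOp (fun p => edge (cosMap (phase K) p)) (continuous_comp_cosMap K edge) ‖edge‖
    (abs_comp_cosMap_le K edge)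

theorem memLp_comp_cosMap (F : C(CosCube, ℝ)) :
    MemLp (fun p => (F (cosMap (phase K) p) : ℂ)) 2 torusMeasure :=
  memLp_ofReal (continuous_comp_cosMap K F) (abs_comp_cosMap_le K F) 2

/-- The even function `p ↦ F ((cos (pᵢ + θᵢ))ᵢ)` on the torus, where `θ` is the phase of `K`. -/
def cubeLift (F : C(CosCube, ℝ)) : evenL2 :=
  ⟨(memLp_comp_cosMap K F).toLp _, by
    have h := (memLp_comp_cosMap K F).coeFn_toLp
    rw [mem_evenL2]
    filter_upwards [h, measurePreserving_neg.quasiMeasurePreserving.ae h] with p hp hneg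
    rw [hp, hneg, cosMap_phase_neg]⟩

theorem coeFn_cubeLift (F : C(CosCube, ℝ)) :
    ∀ᵐ p ∂torusMeasure, (cubeLift K F : L2) p = (F (cosMap (phase K) p) : ℂ) :=
  (memLp_comp_cosMap K F).coeFn_toLp

theorem integral_comp_cosMap_eq_cubeMean (F : C(CosCube, ℝ)) :
    ∫ p, F (cosMap (phase K) p) ∂torusMeasure = (2 * π) ^ 3 * cubeMean F := by
  rw [integral_comp_cosMap F.continuous.measurable, cubeMean_apply,
    mul_inv_cancel_left₀ (by positivity)]

theorem inner_edgeOp_cubeLift (F G : C(CosCube, ℝ)) :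
    inner ℂ (edgeOp K (cubeLift K F)) (cubeLift K G : L2) =
      (((2 * π) ^ 3 * cubeMean (edge * (F * G)) : ℝ) : ℂ) := by
  rw [← integral_comp_cosMap_eq_cubeMean K, ← integral_complex_ofReal, L2.inner_def]
  refine integral_congr_ae ?_
  filter_upwards [coeFn_cubeLift K F, coeFn_cubeLift K G,
    mulOp_apply (continuous_comp_cosMap K edge) (abs_comp_cosMap_le K edge) (cubeLift K F)]
    with p hF hG hmul
  rw [edgeOp, hmul, hF, hG]
  simp [mul_comm, mul_left_comm]

variable {φ : (Fin 3 → ℝ) → ℝ} {C s : ℝ} {H : C(CosCube, ℝ)}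

theorem inner_toLp_cubeLift (hφ : Continuous φ) (hC : ∀ p, |φ p| ≤ C)
    (h : ∀ p, φ p = s * H (cosMap (phase K) p)) (F : C(CosCube, ℝ)) :
    inner ℂ ((memLp_ofReal hφ hC 2).toLp _) (cubeLift K F : L2) =
      ((s * ((2 * π) ^ 3 * cubeMean (H * F)) : ℝ) : ℂ) := by
  rw [← integral_comp_cosMap_eq_cubeMean K, ← integral_const_mul, ← integral_complex_ofReal,
    L2.inner_def]
  refine integral_congr_ae ?_
  filter_upwards [coeFn_cubeLift K F, (memLp_ofReal hφ hC 2).coeFn_toLp] with p hF hp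
  rw [hp, hF, h]
  simp [mul_comm, mul_left_comm]

theorem inner_rankOne_cubeLift (hφ : Continuous φ) (hC : ∀ p, |φ p| ≤ C)
    (h : ∀ p, φ p = s * H (cosMap (phase K) p)) (hs : s ^ 2 = 1) (F G : C(CosCube, ℝ)) :
    inner ℂ (rankOne φ hφ C hC (cubeLift K F)) (cubeLift K G : L2) =
      ((((2 * π) ^ 3) ^ 2 * (cubeMean (H * F) * cubeMean (H * G)) : ℝ) : ℂ) := by
  rw [rankOne_eq, InnerProductSpace.rankOne_apply, inner_smul_left, inner_toLp_cubeLift K hφ hC h,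
    inner_toLp_cubeLift K hφ hC h, Complex.conj_ofReal, ← Complex.ofReal_mul]
  congr 1
  linear_combination ((2 * π) ^ 3) ^ 2 * (cubeMean (H * F) * cubeMean (H * G)) * hs

theorem inner_edgeOp_add_interaction_cubeLift (μ₁ μ₂ : ℝ) (F G : C(CosCube, ℝ)) :
    inner ℂ ((edgeOp K + interaction μ₁ μ₂) (cubeLift K F)) (cubeLift K G : L2) =
      (((2 * π) ^ 3 * cubeForm μ₁ μ₂ F G : ℝ) : ℂ) := by
  have hconst := inner_rankOne_cubeLift K (φ := fun _ => 1) (C := 1) (s := 1) (H := 1)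
    continuous_const (by simp) (by simp) (one_pow 2) F G
  have hcoord i := inner_rankOne_cubeLift K (H := coord i) (continuous_cosCoord i)
    (fun p => abs_cos_le_one (p i)) (fun p => cos_eq_cos_phase_mul K p i) (cos_phase_sq K i) F G
  simp only [interaction, add_apply, smul_apply, sum_apply, inner_add_left,
    inner_smul_left, sum_inner, Complex.conj_ofReal, inner_edgeOp_cubeLift, hconst, hcoord,
    one_mul, cubeForm_apply]
  norm_cast
  rw [← Finset.mul_sum]
  field_simp
  ring

theorem bandBottom_mul_norm_sq_le (f : L2) :
    bandBottom K * ‖f‖ ^ 2 ≤ (freeOp K).reApplyInnerSelf f := by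
  rw [freeOp, reApplyInnerSelf_mulOp, mul_norm_sq_eq_integral]
  refine integral_mono (integrable_mul_norm_sq continuous_const (fun _ => le_rfl) f)
    (integrable_mul_norm_sq (continuous_dispersion K) (abs_dispersion_le K) f) fun p => ?_
  exact mul_le_mul_of_nonneg_right (bandBottom_le_dispersion K p) (sq_nonneg _)

theorem reApplyInnerSelf_freeOp_le (f : L2) :
    (freeOp K).reApplyInnerSelf f ≤ bandBottom K * ‖f‖ ^ 2 + (edgeOp K).reApplyInnerSelf f := by
  have hedge := integrable_mul_norm_sq (continuous_comp_cosMap K edge) (abs_comp_cosMap_le K edge) f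
  have hconst := integrable_mul_norm_sq (continuous_const (y := bandBottom K)) (fun _ => le_rfl) f
  rw [freeOp, edgeOp, reApplyInnerSelf_mulOp, reApplyInnerSelf_mulOp, mul_norm_sq_eq_integral,
    ← integral_add hconst hedge]
  refine integral_mono (integrable_mul_norm_sq (continuous_dispersion K) (abs_dispersion_le K) f)
    (hconst.add hedge) fun p => ?_
  rw [← add_mul]
  exact mul_le_mul_of_nonneg_right (dispersion_le_bandBottom_add_edge K p) (sq_nonneg _)

variable {μ₁ μ₂ : ℝ} {n : ℕ}

theorem reApplyInnerSelf_edgeOp_add_interaction_neg {F : Fin n → C(CosCube, ℝ)}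
    (hF : IsNegativeFamily (cubeForm μ₁ μ₂) F) {c : Fin n → ℂ} (hc : c ≠ 0) :
    (edgeOp K + interaction μ₁ μ₂).reApplyInnerSelf (∑ i, c i • (cubeLift K (F i) : L2)) < 0 := by
  refine reApplyInnerSelf_sum_smul_neg (fun i j hij => ?_) (fun i => ?_) hc
  · rw [inner_edgeOp_add_interaction_cubeLift, hF.1 i j hij, mul_zero, Complex.ofReal_zero]
  · rw [ContinuousLinearMap.reApplyInnerSelf, inner_edgeOp_add_interaction_cubeLift,
      RCLike.re_eq_complex_re, Complex.ofReal_re]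
    exact mul_neg_of_pos_of_neg (by positivity) (hF.2 i)

theorem hasAtLeastEigenvaluesBelow_of_isNegativeFamily {F : Fin n → C(CosCube, ℝ)}
    (hF : IsNegativeFamily (cubeForm μ₁ μ₂) F) :
    HasAtLeastEigenvaluesBelow (hamiltonian μ₁ μ₂ K) n := by
  refine hasAtLeastEigenvaluesBelow_of_form_lt (isSelfAdjoint_hamiltonian μ₁ μ₂ K)
    (hasFiniteRange_hamiltonian_sub_freeHamiltonian μ₁ μ₂ K)
    (fun f => bandBottom_mul_norm_sq_le K f) (fun i => cubeLift K (F i)) fun c hc => ?_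
  have hneg := reApplyInnerSelf_edgeOp_add_interaction_neg K hF hc
  have hcoe : ((∑ i, c i • cubeLift K (F i) : evenL2) : L2) =
      ∑ i, c i • (cubeLift K (F i) : L2) := by
    simp only [Submodule.coe_sum, Submodule.coe_smul]
  rw [← hcoe] at hneg
  set w := ∑ i, c i • cubeLift K (F i)
  have hsplit (A : L2 →L[ℂ] L2) : (A + interaction μ₁ μ₂).reApplyInnerSelf w =
      A.reApplyInnerSelf w + (interaction μ₁ μ₂).reApplyInnerSelf w := by
    simp only [ContinuousLinearMap.reApplyInnerSelf, add_apply, inner_add_left, map_add]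
  calc (hamiltonian μ₁ μ₂ K).reApplyInnerSelf w
      = (freeOp K).reApplyInnerSelf w + (interaction μ₁ μ₂).reApplyInnerSelf w := hsplit _
    _ ≤ bandBottom K * ‖w‖ ^ 2 + (edgeOp K + interaction μ₁ μ₂).reApplyInnerSelf w := by
      rw [hsplit, ← add_assoc]
      exact add_le_add_left (reApplyInnerSelf_freeOp_le K w) _
    _ < bandBottom K * ‖w‖ ^ 2 := add_lt_of_neg_right _ hneg

end CubeLift

section Reflection

theorem dispersion_add_two_pi (K p : Fin 3 → ℝ) :
    dispersion (fun i => K i + 2 * Real.pi) p = 24 - dispersion K p := by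
  have hcos (i : Fin 3) : Real.cos ((K i + 2 * Real.pi) / 2) = -Real.cos (K i / 2) := by
    rw [← Real.cos_add_pi, add_div, mul_div_cancel_left₀ _ two_ne_zero]
  simp only [dispersion, hcos, Fin.sum_univ_three]
  ring

theorem freeOp_add_two_pi_apply (K : Fin 3 → ℝ) (f : L2) :
    freeOp (fun i => K i + 2 * Real.pi) f = (24 : ℂ) • f - freeOp K f := by
  rw [Lp.ext_iff]
  filter_upwards [mulOp_apply (continuous_dispersion fun i => K i + 2 * Real.pi)
      (abs_dispersion_le _) f, mulOp_apply (continuous_dispersion K) (abs_dispersion_le K) f,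
    Lp.coeFn_sub ((24 : ℂ) • f) (freeOp K f), Lp.coeFn_smul (24 : ℂ) f] with p hK' hK hsub hsmul
  rw [freeOp, hK', hsub, Pi.sub_apply, hsmul, Pi.smul_apply, freeOp, hK, smul_eq_mul,
    dispersion_add_two_pi]
  push_cast
  ring

theorem interaction_neg (μ₁ μ₂ : ℝ) : interaction (-μ₁) (-μ₂) = -interaction μ₁ μ₂ := by
  simp only [interaction, mul_neg, neg_div, Complex.ofReal_neg, neg_smul, neg_add]

theorem smul_id_sub_hamiltonian (μ₁ μ₂ : ℝ) (K : Fin 3 → ℝ) :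
    ((24 : ℝ) : ℂ) • ContinuousLinearMap.id ℂ evenL2 - hamiltonian μ₁ μ₂ K =
      hamiltonian (-μ₁) (-μ₂) fun i => K i + 2 * Real.pi := by
  ext1 f
  refine Subtype.ext ?_
  change ((24 : ℝ) : ℂ) • (f : L2) - (freeOp K f + interaction μ₁ μ₂ f) =
    freeOp (fun i => K i + 2 * Real.pi) f + interaction (-μ₁) (-μ₂) f
  rw [freeOp_add_two_pi_apply, interaction_neg, neg_apply, Complex.ofReal_ofNat]
  abel

variable {μ₁ μ₂ : ℝ} {n : ℕ}

theorem neg_mem_AMinus_of_mem_APlus (h : (μ₁, μ₂) ∈ APlus n) : (-μ₁, -μ₂) ∈ AMinus n := by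
  have hcurve : mu2Minus (-μ₁) = -mu2Plus μ₁ := by
    rw [mu2Minus, mu2Plus, neg_add_eq_sub, ← neg_sub μ₁, div_neg]
    ring
  match n, h with
  | 0, ⟨h₁, h₂⟩ =>
    exact ⟨neg_lt_neg h₁, hcurve.trans_lt (neg_lt_neg h₂)⟩
  | 1, .inl (.inl ⟨h₁, h₂⟩) =>
    exact .inl (.inl ⟨neg_lt_neg h₁, (neg_lt_neg h₂).trans_eq hcurve.symm⟩)
  | 1, .inl (.inr h₁) => exact .inl (.inr (congrArg Neg.neg h₁))
  | 1, .inr ⟨h₁, h₂⟩ =>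
    exact .inr ⟨neg_lt_neg h₁, hcurve.trans_lt (neg_lt_neg h₂)⟩
  | 2, ⟨h₁, h₂⟩ =>
    exact ⟨neg_lt_neg h₁, (neg_lt_neg h₂).trans_eq hcurve.symm⟩

theorem hasAtLeastEigenvaluesAbove_of_neg {K : Fin 3 → ℝ}
    (h : HasAtLeastEigenvaluesBelow (hamiltonian (-μ₁) (-μ₂) fun i => K i + 2 * Real.pi) n) :
    HasAtLeastEigenvaluesAbove (hamiltonian μ₁ μ₂ K) n :=
  hasAtLeastEigenvaluesAbove_of_below_sub (smul_id_sub_hamiltonian μ₁ μ₂ K ▸ h)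

end Reflection

section Regions

variable {μ₁ μ₂ : ℝ} {n : ℕ}

theorem hasAtLeastEigenvaluesBelow_of_mem_AMinus (h : (μ₁, μ₂) ∈ AMinus n) (K : Fin 3 → ℝ) :
    HasAtLeastEigenvaluesBelow (hamiltonian μ₁ μ₂ K) n ∧
      (μ₂ ∈ BMinus1 → HasAtLeastEigenvaluesBelow (hamiltonian μ₁ μ₂ K) (n + 2)) := by
  obtain ⟨F, -, hF⟩ := exists_isPermInvariant_isNegativeFamily h
  refine ⟨hasAtLeastEigenvaluesBelow_of_isNegativeFamily K hF, fun h₂ => ?_⟩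
  obtain ⟨F', hF'⟩ := exists_isNegativeFamily_of_mem_BMinus1 h h₂
  exact hasAtLeastEigenvaluesBelow_of_isNegativeFamily K hF'

theorem hasAtLeastEigenvaluesAbove_of_mem_APlus (h : (μ₁, μ₂) ∈ APlus n) (K : Fin 3 → ℝ) :
    HasAtLeastEigenvaluesAbove (hamiltonian μ₁ μ₂ K) n ∧
      (μ₂ ∈ BPlus1 → HasAtLeastEigenvaluesAbove (hamiltonian μ₁ μ₂ K) (n + 2)) :=
  have hbelow := hasAtLeastEigenvaluesBelow_of_mem_AMinus (neg_mem_AMinus_of_mem_APlus h)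
    fun i => K i + 2 * Real.pi
  ⟨hasAtLeastEigenvaluesAbove_of_neg hbelow.1, fun h₂ =>
    hasAtLeastEigenvaluesAbove_of_neg (hbelow.2 (show -μ₂ < -mu2crit from neg_lt_neg h₂))⟩

variable {P : ℕ → Prop}

theorem of_mem_DMinus (h : (μ₁, μ₂) ∈ DMinus n)
    (hP : ∀ k, (μ₁, μ₂) ∈ AMinus k → P k ∧ (μ₂ ∈ BMinus1 → P (k + 2))) : P n :=
  match n, h with
  | 0, h => (hP 0 h).1
  | 1, h => (hP 1 h.1).1
  | 2, h => (hP 2 h).1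
  | 3, h => (hP 1 h.1).2 h.2.2

theorem of_mem_DPlus (h : (μ₁, μ₂) ∈ DPlus n)
    (hP : ∀ k, (μ₁, μ₂) ∈ APlus k → P k ∧ (μ₂ ∈ BPlus1 → P (k + 2))) : P n :=
  match n, h with
  | 0, h => (hP 0 h).1
  | 1, h => (hP 1 h.1).1
  | 2, h => (hP 2 h).1
  | 3, h => (hP 1 h.1).2 h.2.2

end Regions

end TwoBoson

end

theorem theorem4p9_general (μ₁ μ₂ : ℝ) (K : Fin 3 → ℝ) :
    (∀ n, (μ₁, μ₂) ∈ TwoBoson.AMinus n →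
      TwoBoson.HasAtLeastEigenvaluesBelow (TwoBoson.hamiltonian μ₁ μ₂ K) n ∧
        (μ₂ ∈ TwoBoson.BMinus1 →
          TwoBoson.HasAtLeastEigenvaluesBelow (TwoBoson.hamiltonian μ₁ μ₂ K) (n + 2))) ∧
    ∀ n, (μ₁, μ₂) ∈ TwoBoson.APlus n →
      TwoBoson.HasAtLeastEigenvaluesAbove (TwoBoson.hamiltonian μ₁ μ₂ K) n ∧
        (μ₂ ∈ TwoBoson.BPlus1 →
          TwoBoson.HasAtLeastEigenvaluesAbove (TwoBoson.hamiltonian μ₁ μ₂ K) (n + 2)) :=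
  ⟨fun _ h => TwoBoson.hasAtLeastEigenvaluesBelow_of_mem_AMinus h K,
    fun _ h => TwoBoson.hasAtLeastEigenvaluesAbove_of_mem_APlus h K⟩

theorem theorem4p9 (μ₁ μ₂ : ℝ) (α β : ℕ) (hα : α ≤ 3) (hβ : β ≤ 3)
    (hαβ : α + β < 3 ∨ (α, β) = (3, 0) ∨ (α, β) = (0, 3))
    (hG : (μ₁, μ₂) ∈ TwoBoson.G α β)
    (K : Fin 3 → ℝ) (hK : K ∈ TwoBoson.torus) :
    TwoBoson.HasAtLeastEigenvaluesBelow (TwoBoson.hamiltonian μ₁ μ₂ K) α ∧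
      TwoBoson.HasAtLeastEigenvaluesAbove (TwoBoson.hamiltonian μ₁ μ₂ K) β :=
  ⟨TwoBoson.of_mem_DMinus hG.1 (theorem4p9_general μ₁ μ₂ K).1,
    TwoBoson.of_mem_DPlus hG.2 (theorem4p9_general μ₁ μ₂ K).2⟩
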